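/- Let $n,p,r\ge 1$ be integers with $p\ge r$, and put $q=\min(n,r)$, $m=\max(n,r)$. Let $Z$ be a random $r\times n$ matrix whose columns are i.i.d. $\mathcal N_r(0,I_r)$, let $B$ be an unknown real $p\times r$ matrix of full column rank $r$, and put $X=BZ$, $S=XX^t$, $\Sigma=BB^t$. Fix distinct row indices $\rho_1,\dots,\rho_q\in\{1,\dots,p\}$ (for instance $\rho_i=i$) and assume that the rows $\rho_1,\dots,\rho_q$ of $B$ are linearly independent. For an estimator $\delta=\delta(X)$ of $\Sigma$ let $$L_q(\delta,\Sigma)=\operatorname{tr}\Sigma^+\delta-\log\pi(\Sigma^+\delta)-q,\qquad R_q(\delta,\Sigma)=E[L_q(\delta(X),\Sigma)],$$ where $\Sigma^+$ is the Moore–Penrose inverse of $\Sigma$ and $\pi(A)$ is the product of all positive eigenvalues of $A$, counted with multiplicity. With probability one there are unique matrices $T\in\mathbb R^{p\times q}$ and $V\in\mathbb R^{n\times q}$ such that $X=TV^t$, $V^tV=I_q$, and the $q\times q$ matrix formed by the rows $\rho_1,\dots,\rho_q$ of $T$, in this order, is lower triangular with positive diagonal. Consider the class of estimators $\delta_q^T=TD_qT^t$,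 where $D_q=\operatorname{diag}(d_1,\dots,d_q)$ with positive constants $d_i$, and the estimators $\delta_q^C(a)=aS$ with a constant $a>0$. All of them have integrable loss for every such $B$. Let $d_i^{JS}=(n+r-2i+1)^{-1}$ for $i=1,\dots,q$, let $\delta_q^{JS}=T\operatorname{diag}(d_1^{JS},\dots,d_q^{JS})T^t$, and let $\delta_q^{BC}=\frac1m S$. Then, for every $B$ as above: 1. The $d_i^{JS}$ are positive, and $\delta_q^{JS}$ is the unique best estimator in the class $TD_qT^t$: $R_q(\delta_q^{JS},\Sigma)<R_q(TD_qT^t,\Sigma)$ for all positive constants $(d_1,\dots,d_q)\ne(d_1^{JS},\dots,d_q^{JS})$. 2. $\log\pi(ZZ^t)$ is integrable, and $\delta_q^{JS}$ has the constant risk $R_q(\delta_q^{JS},\Sigma)=\sum_{i=1}^q\log(n+r-2i+1)-E[\log\pi(ZZ^t)]$, which does not depend on $B$. 3. $\delta_q^{BC}$ is the unique best constant multiple of $S$: $R_q(\delta_q^{BC},\Sigma)<R_q(aS,\Sigma)$ for all constants $a>0$ with $a\neq 1/m$. 4. $R_q(\delta_q^{JS},\Sigma)\le R_q(\delta_q^{BC},\Sigma)$,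 and the inequality is strict if $q\ge 2$; that is, $\delta_q^{JS}$ strictly dominates $\delta_q^{BC}$ if $q\geq2$. -/

import Mathlib

open MeasureTheory ProbabilityTheory Matrix

namespace SingularWishart

/-- `G` satisfies the four Penrose equations for the real matrix `A`. -/
structure IsPenroseInverse {m n : ℕ} (A : Matrix (Fin m) (Fin n) ℝ)
    (G : Matrix (Fin n) (Fin m) ℝ) : Prop where
  mul_mul_self : A * G * A = A
  self_mul_mul : G * A * G = G
  symm_left : (A * G)ᵀ = A * G
  symm_right : (G * A)ᵀ = G * A

/-- The Penrose equations have at most one solution. -/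
theorem IsPenroseInverse.unique {m n : ℕ} {A : Matrix (Fin m) (Fin n) ℝ}
    {G H : Matrix (Fin n) (Fin m) ℝ} (hG : IsPenroseInverse A G) (hH : IsPenroseInverse A H) :
    G = H := by
  have h1 : A * G = A * H := by
    have e : A * H * (A * G) = A * G := by
      rw [← Matrix.mul_assoc, hH.mul_mul_self]
    have e2 : A * G * (A * H) = A * H := by
      rw [← Matrix.mul_assoc, hG.mul_mul_self]
    have e3 := congrArg Matrix.transpose e
    rw [Matrix.transpose_mul, hG.symm_left, hH.symm_left, e2] at e3
    exact e3.symm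
  have h2 : G * A = H * A := by
    have e : G * A * (H * A) = G * A := by
      rw [Matrix.mul_assoc, ← Matrix.mul_assoc A, hH.mul_mul_self]
    have e2 : H * A * (G * A) = H * A := by
      rw [Matrix.mul_assoc, ← Matrix.mul_assoc A, hG.mul_mul_self]
    have e3 := congrArg Matrix.transpose e
    rw [Matrix.transpose_mul, hG.symm_right, hH.symm_right, e2] at e3
    exact e3.symm
  calc G = G * A * G := hG.self_mul_mul.symm
    _ = H * A * H := by rw [h2, Matrix.mul_assoc, h1, ← Matrix.mul_assoc]
    _ = H := hH.self_mul_mul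

open Classical in
/-- The Moore-Penrose pseudo-inverse `A⁺`: the unique solution of the Penrose equations. -/
noncomputable def pinv {m n : ℕ} (A : Matrix (Fin m) (Fin n) ℝ) : Matrix (Fin n) (Fin m) ℝ :=
  if h : ∃ G, IsPenroseInverse A G then h.choose else 0

theorem pinv_eq {m n : ℕ} {A : Matrix (Fin m) (Fin n) ℝ} {G : Matrix (Fin n) (Fin m) ℝ}
    (hG : IsPenroseInverse A G) : pinv A = G := by
  have h : ∃ G, IsPenroseInverse A G := ⟨G, hG⟩
  rw [pinv, dif_pos h]
  exact h.choose_spec.unique hG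

/-- For `B` of full column rank the pseudo-inverse of `B * Bᵀ` exists
(so the default value in `pinv` is not used for such matrices). -/
theorem isPenroseInverse_pinv_mul_transpose {p r : ℕ} (B : Matrix (Fin p) (Fin r) ℝ)
    (hB : B.rank = r) : IsPenroseInverse (B * Bᵀ) (pinv (B * Bᵀ)) := by
  have hu : IsUnit (Bᵀ * B) := by
    rw [← Matrix.linearIndependent_cols_iff_isUnit, linearIndependent_iff_card_eq_finrank_span,
      Set.finrank, ← Matrix.rank_eq_finrank_span_cols, Matrix.rank_transpose_mul_self, hB,
      Fintype.card_fin]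
  set C := Bᵀ * B with hC
  have hd : IsUnit C.det := (Matrix.isUnit_iff_isUnit_det _).1 hu
  have hCt : Cᵀ = C := by simp [hC]
  have hit : (C⁻¹)ᵀ = C⁻¹ := by rw [Matrix.transpose_nonsing_inv, hCt]
  have l : C⁻¹ * C = 1 := Matrix.nonsing_inv_mul _ hd
  have l' : C * C⁻¹ = 1 := Matrix.mul_nonsing_inv _ hd
  have a1 : B * Bᵀ * (B * (C⁻¹ * C⁻¹) * Bᵀ) = B * C⁻¹ * Bᵀ := by
    calc B * Bᵀ * (B * (C⁻¹ * C⁻¹) * Bᵀ) = B * ((Bᵀ * B) * C⁻¹) * C⁻¹ * Bᵀ := by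
          simp only [Matrix.mul_assoc]
      _ = _ := by rw [← hC, l', Matrix.mul_one]
  have a2 : (B * (C⁻¹ * C⁻¹) * Bᵀ) * (B * Bᵀ) = B * C⁻¹ * Bᵀ := by
    calc (B * (C⁻¹ * C⁻¹) * Bᵀ) * (B * Bᵀ) = B * C⁻¹ * (C⁻¹ * (Bᵀ * B)) * Bᵀ := by
          simp only [Matrix.mul_assoc]
      _ = _ := by rw [← hC, l, Matrix.mul_one]
  have hs : (B * C⁻¹ * Bᵀ)ᵀ = B * C⁻¹ * Bᵀ := by
    simp only [Matrix.transpose_mul, Matrix.transpose_transpose, hit, Matrix.mul_assoc]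
  have key : IsPenroseInverse (B * Bᵀ) (B * (C⁻¹ * C⁻¹) * Bᵀ) := by
    refine ⟨?_, ?_, ?_, ?_⟩
    · rw [a1]
      calc B * C⁻¹ * Bᵀ * (B * Bᵀ) = B * (C⁻¹ * (Bᵀ * B)) * Bᵀ := by
            simp only [Matrix.mul_assoc]
        _ = _ := by rw [← hC, l, Matrix.mul_one]
    · rw [a2]
      calc B * C⁻¹ * Bᵀ * (B * (C⁻¹ * C⁻¹) * Bᵀ)
          = B * (C⁻¹ * (Bᵀ * B)) * (C⁻¹ * C⁻¹) * Bᵀ := by simp only [Matrix.mul_assoc]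
        _ = _ := by rw [← hC, l, Matrix.mul_one]
    · rw [a1, hs]
    · rw [a2, hs]
  rw [pinv_eq key]
  exact key

/-- `π(A)`: the product of all positive (real) eigenvalues of `A`, with multiplicity. -/
noncomputable def posEigenProd {m : ℕ} (A : Matrix (Fin m) (Fin m) ℝ) : ℝ :=
  (A.charpoly.roots.filter (fun x => 0 < x)).prod

/-- The Stein-type loss `L_q(δ, Σ) = tr(Σ⁺ δ) - log π(Σ⁺ δ) - q`. -/
noncomputable def steinLoss {p : ℕ} (q : ℕ) (δ S : Matrix (Fin p) (Fin p) ℝ) : ℝ :=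
  (pinv S * δ).trace - Real.log (posEigenProd (pinv S * δ)) - q

/-- The columns of the random `r × n` matrix `Z` are i.i.d. `N_r(0, I_r)`. -/
structure IsStdGaussianMatrix {Ω : Type*} [MeasurableSpace Ω] (μ : Measure Ω) {r n : ℕ}
    (Z : Ω → Matrix (Fin r) (Fin n) ℝ) : Prop where
  law_col : ∀ j : Fin n,
    HasLaw (fun ω => WithLp.toLp 2 (fun i : Fin r => Z ω i j))
      (stdGaussian (EuclideanSpace ℝ (Fin r))) μ
  indep_col : iIndepFun (fun (j : Fin n) (ω : Ω) => WithLp.toLp 2 (fun i : Fin r => Z ω i j)) μ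

/-- The loss of the estimator `δ` (a function of the data matrix `X = B Z`) of `Σ = B Bᵀ`,
with `q = min n r`, as a random variable. -/
noncomputable def lossVar {Ω : Type*} {p r n : ℕ} (Z : Ω → Matrix (Fin r) (Fin n) ℝ)
    (δ : Matrix (Fin p) (Fin n) ℝ → Matrix (Fin p) (Fin p) ℝ) (B : Matrix (Fin p) (Fin r) ℝ) :
    Ω → ℝ :=
  fun ω => steinLoss (min n r) (δ (B * Z ω)) (B * Bᵀ)

/-- The risk `R_q(δ, Σ) = E[L_q(δ(X), Σ)]`, where `X = B Z` and `Σ = B Bᵀ`. -/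
noncomputable def risk {Ω : Type*} [MeasurableSpace Ω] (μ : Measure Ω) {p r n : ℕ}
    (Z : Ω → Matrix (Fin r) (Fin n) ℝ)
    (δ : Matrix (Fin p) (Fin n) ℝ → Matrix (Fin p) (Fin p) ℝ) (B : Matrix (Fin p) (Fin r) ℝ) : ℝ :=
  ∫ ω, lossVar Z δ B ω ∂μ

/-- `X = T Vᵀ` is the LQ-type decomposition of `X` relative to the row selection `ρ`:
`V` has orthonormal columns, and the rows `ρ 0, ρ 1, …` of `T` form a lower triangular matrix
with positive diagonal. If `ρ` selects the first `q` rows, then this is the block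
condition `T = (T₁ᵗ, T₂ᵗ)ᵗ` with `T₁` lower triangular with positive diagonal. -/
structure IsLQ {p n q : ℕ} (ρ : Fin q ↪ Fin p) (X : Matrix (Fin p) (Fin n) ℝ)
    (T : Matrix (Fin p) (Fin q) ℝ) (V : Matrix (Fin n) (Fin q) ℝ) : Prop where
  eq_mul : X = T * Vᵀ
  orthonormal : Vᵀ * V = 1
  lower : ∀ i j : Fin q, i < j → T (ρ i) j = 0
  diag_pos : ∀ i : Fin q, 0 < T (ρ i) i

open Classical in
/-- The factor `T` of the LQ-type decomposition `X = T Vᵀ` (and `0` if there is none). -/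
noncomputable def lqT {p n q : ℕ} (ρ : Fin q ↪ Fin p) (X : Matrix (Fin p) (Fin n) ℝ) :
    Matrix (Fin p) (Fin q) ℝ :=
  if h : ∃ T : Matrix (Fin p) (Fin q) ℝ, ∃ V : Matrix (Fin n) (Fin q) ℝ, IsLQ ρ X T V
  then h.choose else 0

/-- The estimator `T D Tᵀ` with `D = diag(d)`. -/
noncomputable def deltaT {p n q : ℕ} (ρ : Fin q ↪ Fin p) (d : Fin q → ℝ)
    (X : Matrix (Fin p) (Fin n) ℝ) : Matrix (Fin p) (Fin p) ℝ :=
  lqT ρ X * Matrix.diagonal d * (lqT ρ X)ᵀ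

/-- The constants `1 / (n + r - 2 i + 1)` for `i = 1, …, q`
(the index `i : Fin q` starts at `0`, hence the shift). -/
noncomputable def dJS (n r : ℕ) (i : Fin (min n r)) : ℝ :=
  1 / ((n : ℝ) + (r : ℝ) - 2 * ((i : ℝ) + 1) + 1)

/-- The estimator `a S` with `S = X Xᵀ`. -/
def deltaC {p n : ℕ} (a : ℝ) (X : Matrix (Fin p) (Fin n) ℝ) : Matrix (Fin p) (Fin p) ℝ :=
  a • (X * Xᵀ)

/-- The constant multiple estimator `S / m`, with `m = max n r`. -/
noncomputable def deltaBC {p n : ℕ} (r : ℕ) (X : Matrix (Fin p) (Fin n) ℝ) :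
    Matrix (Fin p) (Fin p) ℝ :=
  deltaC (1 / ((max n r : ℕ) : ℝ)) X

/-- The parameter space: `B` has full column rank, and the rows selected by `ρ`
form a matrix of full row rank. -/
def paramSpace {p r q : ℕ} (ρ : Fin q ↪ Fin p) : Set (Matrix (Fin p) (Fin r) ℝ) :=
  {B | B.rank = r ∧ (B.submatrix ρ id).rank = q}

end SingularWishart

/-! ### Linear algebra: positive eigenvalues and Gram determinants. -/

namespace SingularWishart

/-! Write $N=ZV$, so that $T=BN$. Since $\Sigma^+B$ is a right inverse of $B^t$, the matrices
$\Sigma^+TDT^t$ and $NDN^t$ have the same trace and the same positive eigenvalues. As $NN^t=ZZ^t$,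
the loss is $\sum_i(d_i\|N_i\|^2-\log d_i-1)-\log\pi(ZZ^t)$, where $N_i$ is the $i$-th column of $N$
(`steinLoss_of_isLQ`). Only $E\|N_i\|^2$ and the integrability of the last term are needed.

Factor the selected rows of $B$ as $LO_1$, with $L$ lower triangular with positive diagonal and
$O_1$ the top rows of an orthogonal $O$. Then $V$ comes from Gram–Schmidt on the top $q$ rows of
$OZ$ (`isLQ_lqV`). Since $OZ$ is again standard Gaussian and $\|ON_i\|=\|N_i\|$, the matrix $B$
drops out. Counting $i$ from 1, column $i$ of $ON$ is zero above the diagonal. Each entry below it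
is the product of a Gaussian row with an independent unit vector and has second moment 1; the
squared diagonal entry has mean $n-i+1$. Hence $E\|N_i\|^2=c_i=n+r-2i+1$
(`integral_sum_sq_mul_lqV`).

The risk is thus $\sum_i(d_ic_i-\log d_i-1)$ minus a constant, minimised exactly at $d_i=1/c_i$
because $\log x\le x-1$. Almost surely $aS=T(aI)T^t$, so constant multiples lie in the class; the
$c_i$ average to $m$, which gives $a=1/m$. For $q\ge2$ the $c_i$ differ, whence strict domination.

For $\log\pi(ZZ^t)$, the Gram determinant (of $Z$ or $Z^t$) lies above the square of a maximal
minor, whose moment of order $-1/2$ is finite by integrating out one corner entry at a time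
(`lintegral_det_rpow_le`). The same moment shows that minors almost surely do not vanish, so the
decomposition exists. -/

theorem posEigenProd_mul_comm {a b : ℕ} (A : Matrix (Fin a) (Fin b) ℝ)
    (B : Matrix (Fin b) (Fin a) ℝ) : posEigenProd (A * B) = posEigenProd (B * A) := by
  -- The characteristic polynomials of $AB$ and $BA$ agree up to powers of $X$, which contribute
  -- only the root 0; the filter discards it.
  have key : ∀ (k : ℕ) (P : Polynomial ℝ), P ≠ 0 →
      (Polynomial.X ^ k * P).roots.filter (fun x => 0 < x) = P.roots.filter (fun x => 0 < x) := by
    intro k P hP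
    rw [Polynomial.roots_mul (mul_ne_zero (pow_ne_zero _ Polynomial.X_ne_zero) hP),
      Polynomial.roots_X_pow, Multiset.filter_add]
    simp [Multiset.filter_eq_nil, Multiset.mem_nsmul]
  unfold posEigenProd
  rw [← key (Fintype.card (Fin b)) _ (Matrix.charpoly_monic _).ne_zero,
    Matrix.charpoly_mul_comm', key _ _ (Matrix.charpoly_monic _).ne_zero]

theorem posEigenProd_of_posDef {m : ℕ} {A : Matrix (Fin m) (Fin m) ℝ} (hA : A.PosDef) :
    posEigenProd A = A.det := by
  have hp := hA.eigenvalues_pos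
  unfold posEigenProd
  rw [hA.isHermitian.roots_charpoly_eq_eigenvalues, Multiset.filter_eq_self.2,
    hA.isHermitian.det_eq_prod_eigenvalues]
  · rfl
  · intro x hx
    obtain ⟨i, -, rfl⟩ := Multiset.mem_map.1 hx
    exact hp i

theorem log_det_le_trace {m : ℕ} {A : Matrix (Fin m) (Fin m) ℝ} (hA : A.PosDef) :
    Real.log A.det ≤ A.trace := by
  have hp := hA.eigenvalues_pos
  rw [hA.isHermitian.det_eq_prod_eigenvalues, hA.isHermitian.trace_eq_sum_eigenvalues]
  simp only [RCLike.ofReal_real_eq_id, id_eq]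
  rw [Real.log_prod fun i _ => (hp i).ne']
  exact Finset.sum_le_sum fun i _ => (Real.log_le_sub_one_of_pos (hp i)).trans (by linarith)

theorem one_le_det_one_add {m : ℕ} {A : Matrix (Fin m) (Fin m) ℝ} (hA : A.PosSemidef) :
    1 ≤ (1 + A).det := by
  -- Up to sign, $\det(1+A)$ is the characteristic polynomial at $-1$, so it equals
  -- $\prod(1+\lambda_i)$.
  have h := congrArg (Polynomial.eval (-1)) hA.isHermitian.charpoly_eq
  rw [Matrix.eval_charpoly, Polynomial.eval_prod] at h
  simp only [Polynomial.eval_sub, Polynomial.eval_X, Polynomial.eval_C,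
    RCLike.ofReal_real_eq_id, id_eq] at h
  have e : Matrix.scalar (Fin m) (-1 : ℝ) - A = -(1 + A) := by
    rw [map_neg, map_one]; abel
  have e2 : ∀ i, (-1 : ℝ) - hA.isHermitian.eigenvalues i = -1 * (1 + hA.isHermitian.eigenvalues i) :=
    fun i => by ring
  rw [e, Matrix.det_neg, Finset.prod_congr rfl fun i _ => e2 i, Finset.prod_mul_distrib,
    Finset.prod_const, Finset.card_univ] at h
  rw [mul_left_cancel₀ (pow_ne_zero _ (by norm_num)) h]
  calc (1 : ℝ) = ∏ _i : Fin m, (1 : ℝ) := by simp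
    _ ≤ _ := Finset.prod_le_prod (fun _ _ => zero_le_one) fun i _ => by
      linarith [hA.eigenvalues_nonneg i]

theorem posSemidef_mul_transpose {a b : ℕ} (M : Matrix (Fin a) (Fin b) ℝ) :
    (M * Mᵀ).PosSemidef := by
  simpa using Matrix.posSemidef_self_mul_conjTranspose M

/-- A maximal minor bounds the Gram determinant from below. -/
theorem sq_det_submatrix_le_det {a b : ℕ} (M : Matrix (Fin a) (Fin b) ℝ) (e : Fin a ↪ Fin b) :
    (M.submatrix id e).det ^ 2 ≤ (M * Mᵀ).det := by
  set S := M.submatrix id e with hS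
  by_cases h0 : S.det = 0
  · rw [h0]; simpa using (posSemidef_mul_transpose M).det_nonneg
  have hu : IsUnit S.det := isUnit_iff_ne_zero.2 h0
  classical
  -- `N` is `M` with the selected columns erased, so $MM^t=SS^t+NN^t$; pulling $S$ out on both sides
  -- leaves $\det(1+\text{psd})\ge1$.
  set N : Matrix (Fin a) (Fin b) ℝ := Matrix.of fun i j => if j ∈ Set.range e then 0 else M i j
    with hN
  have hsum : M * Mᵀ = S * Sᵀ + N * Nᵀ := by
    ext i k
    simp only [Matrix.add_apply, Matrix.mul_apply, Matrix.transpose_apply, hS, hN,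
      Matrix.submatrix_apply, id, Matrix.of_apply]
    have : ∑ x, M i (e x) * M k (e x) = ∑ j, if j ∈ Set.range e then M i j * M k j else 0 := by
      rw [← Finset.sum_filter, ← Finset.sum_map Finset.univ e (fun j => M i j * M k j)]
      congr 1
      ext j
      simp
    rw [this, ← Finset.sum_add_distrib]
    refine Finset.sum_congr rfl fun j _ => ?_
    split_ifs <;> simp
  have hfac : S * Sᵀ + N * Nᵀ = S * (1 + (S⁻¹ * N) * (S⁻¹ * N)ᵀ) * Sᵀ := by
    have h1 : S * S⁻¹ = 1 := Matrix.mul_nonsing_inv _ hu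
    have h2 : (S⁻¹)ᵀ * Sᵀ = 1 := by rw [← Matrix.transpose_mul, h1, Matrix.transpose_one]
    rw [Matrix.mul_add, Matrix.add_mul, Matrix.mul_one, Matrix.transpose_mul]
    congr 1
    calc N * Nᵀ = (S * S⁻¹) * N * Nᵀ * ((S⁻¹)ᵀ * Sᵀ) := by rw [h1, h2]; simp
      _ = _ := by simp only [Matrix.mul_assoc]
  rw [hsum, hfac, Matrix.det_mul, Matrix.det_mul, Matrix.det_transpose]
  have := one_le_det_one_add (posSemidef_mul_transpose (S⁻¹ * N))
  nlinarith [sq_nonneg S.det]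

theorem posDef_mul_transpose {a b : ℕ} {M : Matrix (Fin a) (Fin b) ℝ}
    (h : (M * Mᵀ).det ≠ 0) : (M * Mᵀ).PosDef :=
  (posSemidef_mul_transpose M).posDef_iff_det_ne_zero.2 h

theorem linearIndependent_of_det_submatrix_ne_zero {a b : ℕ} {M : Matrix (Fin a) (Fin b) ℝ}
    {e : Fin a → Fin b} (h : (M.submatrix id e).det ≠ 0) : LinearIndependent ℝ M.row := by
  have := Matrix.linearIndependent_rows_of_det_ne_zero h
  exact LinearIndependent.of_comp (LinearMap.funLeft ℝ ℝ e) this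

end SingularWishart

/-! ### Uniqueness of the LQ decomposition and the loss as a function of $ZV$. -/

namespace SingularWishart

/-- Forward substitution, row by row. -/
theorem lower_of_mul_lower {q : ℕ} {K K' W : Matrix (Fin q) (Fin q) ℝ}
    (hK : ∀ i j, i < j → K i j = 0) (hKd : ∀ i, 0 < K i i) (hK' : ∀ i j, i < j → K' i j = 0)
    (h : K * W = K') (i j : Fin q) (hij : i < j) : W i j = 0 := by
  induction i using WellFoundedLT.induction with
  | _ i ih =>
    have e := congrFun (congrFun h i) j
    rw [hK' i j hij, Matrix.mul_apply, Finset.sum_eq_single i] at e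
    · exact (mul_eq_zero.1 e).resolve_left (hKd i).ne'
    · intro k _ hk
      rcases lt_or_gt_of_ne hk with hlt | hgt
      · rw [ih k hlt (hlt.trans hij), mul_zero]
      · rw [hK i k hgt, zero_mul]
    · simp

theorem det_ne_zero_of_lower {q : ℕ} {K : Matrix (Fin q) (Fin q) ℝ}
    (hK : ∀ i j, i < j → K i j = 0) (hKd : ∀ i, 0 < K i i) : K.det ≠ 0 := by
  rw [Matrix.det_of_isLowerTriangular K fun i j hij => hK i j hij]
  exact (Finset.prod_pos fun i _ => hKd i).ne'

/-- With $W=V^tV'$ one has $KW=K'$ and $K'W^t=K$, so $W$ and $W^t$ are both lower triangular. Thus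
$W$ is diagonal with positive entries of square 1, i.e. $W=1$, and then $(V-V')^t(V-V')=0$. -/
theorem lq_unique {q n : ℕ} {K K' : Matrix (Fin q) (Fin q) ℝ} {V V' : Matrix (Fin n) (Fin q) ℝ}
    (hK : ∀ i j, i < j → K i j = 0) (hKd : ∀ i, 0 < K i i)
    (hK' : ∀ i j, i < j → K' i j = 0) (hKd' : ∀ i, 0 < K' i i)
    (hV : Vᵀ * V = 1) (hV' : V'ᵀ * V' = 1) (h : K * Vᵀ = K' * V'ᵀ) : V = V' := by
  have h1 : K * (Vᵀ * V') = K' := by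
    rw [← Matrix.mul_assoc, h, Matrix.mul_assoc, hV', Matrix.mul_one]
  have h2 : K' * (Vᵀ * V')ᵀ = K := by
    rw [Matrix.transpose_mul, Matrix.transpose_transpose, ← Matrix.mul_assoc, ← h,
      Matrix.mul_assoc, hV, Matrix.mul_one]
  set W := Vᵀ * V' with hW
  have l1 := lower_of_mul_lower hK hKd hK' h1
  have l2 := lower_of_mul_lower hK' hKd' hK h2
  have hoff : ∀ i j, i ≠ j → W i j = 0 := fun i j hij => by
    rcases lt_or_gt_of_ne hij with hlt | hgt
    · exact l1 i j hlt
    · exact l2 j i hgt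
  have d1 : ∀ i, K i i * W i i = K' i i := fun i => by
    rw [← h1, Matrix.mul_apply, Finset.sum_eq_single i (fun k _ hk => by rw [hoff k i hk, mul_zero])
      (by simp)]
  have d2 : ∀ i, K' i i * W i i = K i i := fun i => by
    conv_rhs => rw [← h2]
    rw [Matrix.mul_apply, Finset.sum_eq_single i
      (fun k _ hk => by rw [Matrix.transpose_apply, hoff i k hk.symm, mul_zero]) (by simp)]
    rfl
  have hW1 : W = 1 := by
    ext i j
    by_cases hij : i = j
    · subst hij
      rw [Matrix.one_apply_eq]
      have a := d1 i
      have b := d2 i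
      have hp : 0 < W i i := by
        by_contra hn
        nlinarith [hKd i, hKd' i, mul_nonneg (hKd i).le (not_lt.1 hn |> neg_nonneg.2)]
      have : K i i * (W i i * W i i) = K i i * 1 := by rw [← mul_assoc, a, b, mul_one]
      have := mul_left_cancel₀ (hKd i).ne' this
      nlinarith
    · rw [Matrix.one_apply_ne hij, hoff i j hij]
  have hz : (V - V')ᵀ * (V - V') = 0 := by
    have hW2 : V'ᵀ * V = 1 := by
      have := congrArg Matrix.transpose hW1
      rwa [hW, Matrix.transpose_mul, Matrix.transpose_transpose, Matrix.transpose_one] at this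
    rw [Matrix.transpose_sub, Matrix.sub_mul, Matrix.mul_sub, Matrix.mul_sub, hV, hV', hW2, ← hW,
      hW1]
    simp
  have hz' : (V - V')ᴴ * (V - V') = 0 := by simpa using hz
  exact sub_eq_zero.1 (Matrix.conjTranspose_mul_self_eq_zero.1 hz')

theorem IsLQ.unique {p n q : ℕ} {ρ : Fin q ↪ Fin p} {X : Matrix (Fin p) (Fin n) ℝ}
    {T T' : Matrix (Fin p) (Fin q) ℝ} {V V' : Matrix (Fin n) (Fin q) ℝ}
    (h : IsLQ ρ X T V) (h' : IsLQ ρ X T' V') : T = T' ∧ V = V' := by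
  have key : T.submatrix ρ id * Vᵀ = T'.submatrix ρ id * V'ᵀ := by
    have e : ∀ (T : Matrix (Fin p) (Fin q) ℝ) (V : Matrix (Fin n) (Fin q) ℝ),
        T.submatrix ρ id * Vᵀ = (T * Vᵀ).submatrix ρ id := fun _ _ => rfl
    rw [e, e, ← h.eq_mul, ← h'.eq_mul]
  have hVV : V = V' := lq_unique (fun i j hij => h.lower i j hij) (fun i => h.diag_pos i)
    (fun i j hij => h'.lower i j hij) (fun i => h'.diag_pos i) h.orthonormal h'.orthonormal key
  refine ⟨?_, hVV⟩
  have e1 : X * V = T := by rw [h.eq_mul, Matrix.mul_assoc, h.orthonormal, Matrix.mul_one]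
  have e2 : X * V' = T' := by rw [h'.eq_mul, Matrix.mul_assoc, h'.orthonormal, Matrix.mul_one]
  rw [← e1, ← e2, hVV]

theorem IsLQ.lqT_eq {p n q : ℕ} {ρ : Fin q ↪ Fin p} {X : Matrix (Fin p) (Fin n) ℝ}
    {T : Matrix (Fin p) (Fin q) ℝ} {V : Matrix (Fin n) (Fin q) ℝ}
    (h : IsLQ ρ X T V) : lqT ρ X = T := by
  have hex : ∃ T : Matrix (Fin p) (Fin q) ℝ, ∃ V : Matrix (Fin n) (Fin q) ℝ, IsLQ ρ X T V :=
    ⟨T, V, h⟩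
  rw [lqT, dif_pos hex]
  obtain ⟨V', hV'⟩ := hex.choose_spec
  exact (hV'.unique h).1

theorem isUnit_transpose_mul_self {p r : ℕ} {B : Matrix (Fin p) (Fin r) ℝ} (hB : B.rank = r) :
    IsUnit (Bᵀ * B).det := by
  rw [← Matrix.isUnit_iff_isUnit_det, ← Matrix.linearIndependent_cols_iff_isUnit,
    linearIndependent_iff_card_eq_finrank_span, Set.finrank, ← Matrix.rank_eq_finrank_span_cols,
    Matrix.rank_transpose_mul_self, hB, Fintype.card_fin]

theorem mul_left_cancel_of_rank {p r n : ℕ} {B : Matrix (Fin p) (Fin r) ℝ} (hB : B.rank = r)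
    {M N : Matrix (Fin r) (Fin n) ℝ} (h : B * M = B * N) : M = N := by
  have l := Matrix.nonsing_inv_mul _ (isUnit_transpose_mul_self hB)
  calc M = (Bᵀ * B)⁻¹ * (Bᵀ * B) * M := by rw [l, Matrix.one_mul]
    _ = (Bᵀ * B)⁻¹ * Bᵀ * (B * M) := by simp only [Matrix.mul_assoc]
    _ = (Bᵀ * B)⁻¹ * (Bᵀ * B) * N := by rw [h]; simp only [Matrix.mul_assoc]
    _ = N := by rw [l, Matrix.one_mul]

/-- The pseudo-inverse of `B Bᵀ` acts as a left inverse up to cyclic permutation. -/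
theorem exists_pinv_mul_eq {p r : ℕ} {B : Matrix (Fin p) (Fin r) ℝ} (hB : B.rank = r) :
    ∃ G : Matrix (Fin p) (Fin r) ℝ, Bᵀ * G = 1 ∧
      ∀ M : Matrix (Fin r) (Fin r) ℝ, pinv (B * Bᵀ) * (B * M * Bᵀ) = G * (M * Bᵀ) := by
  have l := Matrix.nonsing_inv_mul _ (isUnit_transpose_mul_self hB)
  have l' := Matrix.mul_nonsing_inv _ (isUnit_transpose_mul_self hB)
  have hP := isPenroseInverse_pinv_mul_transpose B hB
  set P := pinv (B * Bᵀ)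
  -- Cancelling the injective $B$ in $\Sigma\Sigma^+\Sigma=\Sigma$ gives $B^t\Sigma^+BB^t=B^t$;
  -- multiply by $B(B^tB)^{-1}$ on the right.
  have h1 : Bᵀ * (P * B) = 1 := by
    have h := hP.mul_mul_self
    have h2 : B * (Bᵀ * P * B * Bᵀ) = B * Bᵀ := by
      refine Eq.trans ?_ h
      simp only [Matrix.mul_assoc]
    have h3 := mul_left_cancel_of_rank hB h2
    calc Bᵀ * (P * B) = (Bᵀ * P * B * Bᵀ) * B * (Bᵀ * B)⁻¹ := by
          rw [Matrix.mul_assoc (Bᵀ * P * B), Matrix.mul_assoc (Bᵀ * P * B), l',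
            Matrix.mul_one, Matrix.mul_assoc]
      _ = 1 := by rw [h3, l']
  exact ⟨P * B, h1, fun M => by simp only [Matrix.mul_assoc]⟩

theorem IsLQ.mul_mul_transpose {p r n q : ℕ} {ρ : Fin q ↪ Fin p} {B : Matrix (Fin p) (Fin r) ℝ}
    (hB : B.rank = r) {Z : Matrix (Fin r) (Fin n) ℝ} {T : Matrix (Fin p) (Fin q) ℝ}
    {V : Matrix (Fin n) (Fin q) ℝ} (h : IsLQ ρ (B * Z) T V) : Z * V * Vᵀ = Z := by
  refine mul_left_cancel_of_rank hB ?_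
  rw [← Matrix.mul_assoc, ← Matrix.mul_assoc, h.eq_mul, Matrix.mul_assoc T, h.orthonormal,
    Matrix.mul_one]

/-- Cyclic invariance of trace and `posEigenProd` removes $B$, which survives only through its
influence on $V$. -/
theorem steinLoss_of_isLQ {p r n q : ℕ} {ρ : Fin q ↪ Fin p} {B : Matrix (Fin p) (Fin r) ℝ}
    (hB : B.rank = r) {Z : Matrix (Fin r) (Fin n) ℝ} {T : Matrix (Fin p) (Fin q) ℝ}
    {V : Matrix (Fin n) (Fin q) ℝ} (h : IsLQ ρ (B * Z) T V) {d : Fin q → ℝ} (hd : ∀ i, 0 < d i) :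
    steinLoss q (T * Matrix.diagonal d * Tᵀ) (B * Bᵀ)
      = ∑ i, d i * ∑ k, ((Z * V) k i) ^ 2 - ∑ i, Real.log (d i)
        - Real.log (posEigenProd (Z * Zᵀ)) - q := by
  obtain ⟨G, hG, hGM⟩ := exists_pinv_mul_eq hB
  have hT : T = B * (Z * V) := by
    rw [← Matrix.mul_assoc, h.eq_mul, Matrix.mul_assoc, h.orthonormal, Matrix.mul_one]
  obtain ⟨N, hN⟩ : ∃ N, N = Z * V := ⟨_, rfl⟩
  rw [← hN] at hT ⊢
  have hS : pinv (B * Bᵀ) * (T * Matrix.diagonal d * Tᵀ) = G * (N * Matrix.diagonal d * Nᵀ * Bᵀ) := by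
    rw [← hGM, hT, Matrix.transpose_mul]
    simp only [Matrix.mul_assoc]
  have hcomm : N * Matrix.diagonal d * Nᵀ * Bᵀ * G = N * Matrix.diagonal d * Nᵀ := by
    rw [Matrix.mul_assoc, hG, Matrix.mul_one]
  -- `N` is injective because the selected rows of $BN=T$ already form an invertible triangular
  -- matrix.
  have hdet : (Nᵀ * N).det ≠ 0 := by
    have hK := det_ne_zero_of_lower (K := T.submatrix ρ id) (fun i j hij => h.lower i j hij)
      (fun i => h.diag_pos i)
    have hinj : Function.Injective N.mulVec := by
      intro x y hxy
      have : (T.submatrix ρ id) *ᵥ x = (T.submatrix ρ id) *ᵥ y := by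
        have e : ∀ x, (T.submatrix ρ id) *ᵥ x = fun i => (B *ᵥ (N *ᵥ x)) (ρ i) := fun x => by
          rw [Matrix.mulVec_mulVec, ← hT]; rfl
        rw [e, e, hxy]
      exact Matrix.mulVec_injective_iff_isUnit.2
        ((Matrix.isUnit_iff_isUnit_det _).2 (isUnit_iff_ne_zero.2 hK)) this
    have := (Matrix.PosDef.conjTranspose_mul_self N hinj).det_pos.ne'
    simpa using this
  have hpd : (Nᵀ * N).PosDef := by
    have := posDef_mul_transpose (M := Nᵀ) (by simpa using hdet)
    simpa using this
  have hZ : posEigenProd (Z * Zᵀ) = (Nᵀ * N).det := by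
    have e : N * Nᵀ = Z * Zᵀ := by
      rw [hN, Matrix.transpose_mul, ← Matrix.mul_assoc, h.mul_mul_transpose hB]
    rw [← posEigenProd_of_posDef hpd, posEigenProd_mul_comm Nᵀ, e]
  have hpi : posEigenProd (N * Matrix.diagonal d * Nᵀ) = (∏ i, d i) * (Nᵀ * N).det := by
    -- Splitting $D=s^2$ turns the cyclically permuted product into the positive definite
    -- $(sN^t)(sN^t)^t$.
    set s : Matrix (Fin q) (Fin q) ℝ := Matrix.diagonal fun i => Real.sqrt (d i) with hs
    have hss : s * s = Matrix.diagonal d := by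
      rw [hs, Matrix.diagonal_mul_diagonal]
      congr 1; ext i; exact Real.mul_self_sqrt (hd i).le
    have hst : sᵀ = s := Matrix.diagonal_transpose _
    have e : N * Matrix.diagonal d * Nᵀ = (N * s) * (s * Nᵀ) := by
      rw [← hss]; simp only [Matrix.mul_assoc]
    have e2 : (s * Nᵀ) * (N * s) = (s * Nᵀ) * (s * Nᵀ)ᵀ := by
      rw [Matrix.transpose_mul, hst, Matrix.transpose_transpose]
    have hdets : ((s * Nᵀ) * (N * s)).det = (∏ i, d i) * (Nᵀ * N).det := by
      rw [Matrix.mul_assoc, ← Matrix.mul_assoc Nᵀ, Matrix.det_mul, Matrix.det_mul, mul_comm,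
        mul_assoc, ← Matrix.det_mul, hss, Matrix.det_diagonal, mul_comm]
    rw [e, posEigenProd_mul_comm, ← hdets, e2]
    refine posEigenProd_of_posDef (posDef_mul_transpose ?_)
    rw [← e2, hdets]
    exact mul_ne_zero (Finset.prod_pos fun i _ => hd i).ne' hdet
  have htr : (N * Matrix.diagonal d * Nᵀ).trace = ∑ i, d i * ∑ k, (N k i) ^ 2 := by
    have hk : ∀ k, (N * Matrix.diagonal d * Nᵀ) k k = ∑ i, d i * (N k i) ^ 2 := fun k => by
      rw [Matrix.mul_apply]
      simp only [Matrix.mul_diagonal, Matrix.transpose_apply]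
      exact Finset.sum_congr rfl fun i _ => by ring
    simp only [Matrix.trace, Matrix.diag_apply, hk, Finset.mul_sum]
    exact Finset.sum_comm
  rw [steinLoss, hS, posEigenProd_mul_comm, Matrix.trace_mul_comm, hcomm, htr, hpi, hZ,
    Real.log_mul (Finset.prod_pos fun i _ => hd i).ne' hdet, Real.log_prod fun i _ => (hd i).ne']
  ring

end SingularWishart

/-! ### Existence of the decomposition by Gram–Schmidt. -/

namespace SingularWishart
open InnerProductSpace

/-- The rows of `M`, orthonormalised by the Gram-Schmidt process, as the columns of a matrix. -/
noncomputable def lqV {q n : ℕ} (M : Matrix (Fin q) (Fin n) ℝ) : Matrix (Fin n) (Fin q) ℝ :=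
  Matrix.of fun a j => gramSchmidtNormed ℝ (fun i => WithLp.toLp 2 (M i)) j a

theorem measurable_gramSchmidt {α E : Type*} [MeasurableSpace α] [NormedAddCommGroup E]
    [InnerProductSpace ℝ E] [FiniteDimensional ℝ E] [MeasurableSpace E] [BorelSpace E]
    {q : ℕ} {x : α → Fin q → E} (hx : ∀ i, Measurable fun ω => x ω i) (j : Fin q) :
    Measurable fun ω => gramSchmidt ℝ (x ω) j := by
  induction j using WellFoundedLT.induction with
  | _ j ih =>
    simp only [gramSchmidt_def ℝ _ j, Submodule.starProjection_singleton]
    refine (hx j).sub (Finset.measurable_sum _ fun i hi => ?_)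
    have hi' := ih i (Finset.mem_Iio.1 hi)
    exact ((hi'.inner (hx j)).div (by simpa using hi'.norm.pow_const 2)).smul hi'

theorem measurable_lqV {q n : ℕ} (a : Fin n) (j : Fin q) :
    Measurable fun M : Fin q → Fin n → ℝ => lqV (Matrix.of M) a j := by
  have h := measurable_gramSchmidt (α := Fin q → Fin n → ℝ) (E := EuclideanSpace ℝ (Fin n))
    (x := fun M i => WithLp.toLp 2 (M i)) (fun i => by fun_prop) j
  have h2 : Measurable fun M : Fin q → Fin n → ℝ =>
      gramSchmidtNormed ℝ (fun i => (WithLp.toLp 2 (M i) : EuclideanSpace ℝ (Fin n))) j := by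
    unfold gramSchmidtNormed
    exact (by simpa using h.norm.inv : Measurable _).smul h
  have h3 : Measurable fun v : EuclideanSpace ℝ (Fin n) => v a := by fun_prop
  exact h3.comp h2

/-- This locality is what later makes a column of $V$ independent of all lower rows of the Gaussian
matrix. -/
theorem gramSchmidt_congr {E : Type*} [NormedAddCommGroup E] [InnerProductSpace ℝ E] {q : ℕ}
    {x y : Fin q → E} (j : Fin q) (h : ∀ i ≤ j, x i = y i) :
    gramSchmidt ℝ x j = gramSchmidt ℝ y j := by
  induction j using WellFoundedLT.induction with
  | _ j ih =>
    rw [gramSchmidt_def, gramSchmidt_def, h j le_rfl]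
    congr 1
    refine Finset.sum_congr rfl fun i hi => ?_
    have hi' := Finset.mem_Iio.1 hi
    rw [ih i hi' fun k hk => h k (hk.trans hi'.le)]

theorem lqV_congr {q n : ℕ} {M M' : Matrix (Fin q) (Fin n) ℝ} (j : Fin q) (h : ∀ i ≤ j, M i = M' i)
    (a : Fin n) : lqV M a j = lqV M' a j := by
  simp only [lqV, Matrix.of_apply, gramSchmidtNormed]
  rw [gramSchmidt_congr j fun i hi => by rw [h i hi]]

/-- For dependent rows a normalised vector may be 0, hence only an inequality; it holds at every
sample point and serves as a dominating bound. -/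
theorem sum_sq_lqV_le_one {q n : ℕ} (M : Matrix (Fin q) (Fin n) ℝ) (j : Fin q) :
    ∑ a, (lqV M a j) ^ 2 ≤ 1 := by
  have e : ∑ a, (lqV M a j) ^ 2
      = ‖gramSchmidtNormed ℝ (fun i => (WithLp.toLp 2 (M i) : EuclideanSpace ℝ (Fin n))) j‖ ^ 2 := by
    rw [EuclideanSpace.real_norm_sq_eq]; rfl
  rw [e]
  by_cases h0 : gramSchmidtNormed ℝ (fun i => (WithLp.toLp 2 (M i) : EuclideanSpace ℝ (Fin n))) j = 0
  · rw [h0]; simp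
  · rw [gramSchmidtNormed_unit_length' h0]; simp

theorem mul_lqV_apply {q n s : ℕ} (M : Matrix (Fin q) (Fin n) ℝ) (N : Matrix (Fin s) (Fin n) ℝ)
    (i : Fin s) (j : Fin q) :
    (N * lqV M) i j = inner ℝ (gramSchmidtNormed ℝ
      (fun i => (WithLp.toLp 2 (M i) : EuclideanSpace ℝ (Fin n))) j) (WithLp.toLp 2 (N i)) := by
  rw [EuclideanSpace.inner_eq_star_dotProduct]
  simp [Matrix.mul_apply, lqV, dotProduct]

theorem mul_lqV_lower {q n : ℕ} (M : Matrix (Fin q) (Fin n) ℝ) (i j : Fin q) (hij : i < j) :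
    (M * lqV M) i j = 0 := by
  rw [mul_lqV_apply, gramSchmidtNormed, inner_smul_left, gramSchmidt_inv_triangular ℝ _ hij,
    mul_zero]

theorem linearIndependent_toLp {q n : ℕ} {M : Matrix (Fin q) (Fin n) ℝ}
    (h : LinearIndependent ℝ M.row) :
    LinearIndependent ℝ fun i => (WithLp.toLp 2 (M i) : EuclideanSpace ℝ (Fin n)) :=
  h.map' (WithLp.linearEquiv 2 ℝ (Fin n → ℝ)).symm.toLinearMap (LinearEquiv.ker _)

theorem lqV_orthonormal {q n : ℕ} {M : Matrix (Fin q) (Fin n) ℝ}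
    (h : LinearIndependent ℝ M.row) : (lqV M)ᵀ * lqV M = 1 := by
  have ho := orthonormal_iff_ite.1 (gramSchmidtNormed_orthonormal (linearIndependent_toLp h))
  ext i j
  rw [mul_lqV_apply, Matrix.one_apply, ← ho i j, real_inner_comm]
  rfl

theorem mul_lqV_mul_transpose {q n : ℕ} {M : Matrix (Fin q) (Fin n) ℝ}
    (h : LinearIndependent ℝ M.row) : M * lqV M * (lqV M)ᵀ = M := by
  have hL := linearIndependent_toLp h
  have ho := gramSchmidtNormed_orthonormal hL
  ext i a
  have hm : (WithLp.toLp 2 (M i) : EuclideanSpace ℝ (Fin n)) ∈ Submodule.span ℝ (Set.range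
      (gramSchmidtNormed ℝ fun i => (WithLp.toLp 2 (M i) : EuclideanSpace ℝ (Fin n)))) := by
    rw [span_gramSchmidtNormed_range, span_gramSchmidt]
    exact Submodule.subset_span ⟨i, rfl⟩
  obtain ⟨c, hc⟩ := (Submodule.mem_span_range_iff_exists_fun ℝ).1 hm
  have hc' : ∀ j, (M * lqV M) i j = c j := fun j => by
    rw [mul_lqV_apply, ← hc, ho.inner_right_fintype]
  rw [Matrix.mul_apply]
  have := congrArg (fun v : EuclideanSpace ℝ (Fin n) => v a) hc
  simp only [WithLp.ofLp_sum, WithLp.ofLp_smul, Finset.sum_apply, Pi.smul_apply, smul_eq_mul]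
    at this
  rw [← this]
  exact Finset.sum_congr rfl fun j _ => by rw [hc']; rfl

/-- The $i$-th row differs from its Gram–Schmidt vector by something orthogonal to that vector, so
the diagonal entry is the norm of the vector. -/
theorem mul_lqV_diag_pos {q n : ℕ} {M : Matrix (Fin q) (Fin n) ℝ}
    (h : LinearIndependent ℝ M.row) (i : Fin q) : 0 < (M * lqV M) i i := by
  have hL := linearIndependent_toLp h
  have h0 := gramSchmidt_ne_zero i hL
  rw [mul_lqV_apply, gramSchmidtNormed, inner_smul_left]
  have e : inner ℝ (gramSchmidt ℝ (fun i => (WithLp.toLp 2 (M i) : EuclideanSpace ℝ (Fin n))) i)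
      (WithLp.toLp 2 (M i))
      = ‖gramSchmidt ℝ (fun i => (WithLp.toLp 2 (M i) : EuclideanSpace ℝ (Fin n))) i‖ ^ 2 := by
    conv_lhs => rw [gramSchmidt_def'' ℝ (fun i => (WithLp.toLp 2 (M i) : EuclideanSpace ℝ (Fin n))) i]
    rw [inner_add_right, inner_sum, Finset.sum_eq_zero, add_zero, real_inner_self_eq_norm_sq]
    intro k hk
    rw [inner_smul_right, gramSchmidt_orthogonal ℝ _ (Finset.mem_Iio.1 hk).ne', mul_zero]
  rw [e]
  have := norm_pos_iff.2 h0
  simp only [map_inv₀, RCLike.ofReal_real_eq_id, id_eq, conj_trivial]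
  positivity

/-- A matrix of full row rank is a lower triangular matrix with positive diagonal times
the first rows of an orthogonal matrix. -/
theorem exists_lower_mul_orthogonal {q r : ℕ} (hqr : q ≤ r) {A : Matrix (Fin q) (Fin r) ℝ}
    (hA : A.rank = q) :
    ∃ (L : Matrix (Fin q) (Fin q) ℝ) (O : Matrix (Fin r) (Fin r) ℝ),
      (∀ i j, i < j → L i j = 0) ∧ (∀ i, 0 < L i i) ∧ O * Oᵀ = 1 ∧
        A = L * O.submatrix (Fin.castLE hqr) id := by
  have hli : LinearIndependent ℝ A.row := by
    rw [linearIndependent_iff_card_eq_finrank_span, Set.finrank, ← Matrix.rank_eq_finrank_span_row,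
      hA, Fintype.card_fin]
  have hL := linearIndependent_toLp hli
  have ho := gramSchmidtNormed_orthonormal hL
  set v := gramSchmidtNormed ℝ fun i => (WithLp.toLp 2 (A i) : EuclideanSpace ℝ (Fin r)) with hv
  let w : Fin r → EuclideanSpace ℝ (Fin r) := fun k => if hk : k.1 < q then v ⟨k.1, hk⟩ else 0
  have how : Orthonormal ℝ ((Set.range (Fin.castLE hqr)).domRestrict w) := by
    have hk : ∀ k : Set.range (Fin.castLE hqr), k.1.1 < q := fun ⟨k, i, hi⟩ => by
      exact hi ▸ i.2
    have hw : (Set.range (Fin.castLE hqr)).domRestrict w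
        = v ∘ fun k => (⟨k.1.1, hk k⟩ : Fin q) := by
      ext1 k
      simp only [Set.domRestrict_apply, w, dif_pos (hk k), Function.comp]
    rw [hw]
    exact ho.comp _ fun k l hkl => Subtype.ext (Fin.ext (by simpa using hkl))
  obtain ⟨b, hb⟩ := how.exists_orthonormalBasis_extension_of_card_eq (by simp)
  refine ⟨A * lqV A, Matrix.of fun k a => b k a, mul_lqV_lower A, mul_lqV_diag_pos hli, ?_, ?_⟩
  · ext k l
    have := orthonormal_iff_ite.1 b.orthonormal l k
    rw [EuclideanSpace.inner_eq_star_dotProduct] at this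
    rw [Matrix.one_apply]
    simp only [dotProduct, star_trivial] at this
    simp only [Matrix.mul_apply, Matrix.of_apply, Matrix.transpose_apply]
    rw [this]
    simp [eq_comm]
  · have e : (Matrix.of fun k a => b k a : Matrix (Fin r) (Fin r) ℝ).submatrix (Fin.castLE hqr) id
        = (lqV A)ᵀ := by
      ext i a
      have := hb (Fin.castLE hqr i) ⟨i, rfl⟩
      simp only [Matrix.submatrix_apply, Matrix.of_apply, this, w, id]
      rw [dif_pos (show (Fin.castLE hqr i).1 < q from i.2)]
      rfl
    rw [e, mul_lqV_mul_transpose hli]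

/-- If $q=r$ the top rows are all of $Z$; if $q=n$ then $V$ is square and $VV^t=1$. This is where
$q=\min(n,r)$ matters. -/
theorem mul_lqV_mul_transpose_of_top {q r n : ℕ} (hqr : q ≤ r) (hq : q = r ∨ q = n)
    {Z : Matrix (Fin r) (Fin n) ℝ}
    (h : LinearIndependent ℝ (Z.submatrix (Fin.castLE hqr) id).row) :
    Z * lqV (Z.submatrix (Fin.castLE hqr) id) * (lqV (Z.submatrix (Fin.castLE hqr) id))ᵀ = Z := by
  rcases hq with rfl | rfl
  · exact mul_lqV_mul_transpose h
  · rw [Matrix.mul_assoc, mul_eq_one_comm.1 (lqV_orthonormal h), Matrix.mul_one]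

/-- The selected rows of $BZ$ are $L$ times the top rows of $OZ$, and a product of lower triangular
matrices with positive diagonals is of the same kind. So both share the factor $V$. -/
theorem isLQ_lqV {p q r n : ℕ} {ρ : Fin q ↪ Fin p} (hqr : q ≤ r) (hq : q = r ∨ q = n)
    {B : Matrix (Fin p) (Fin r) ℝ} {L : Matrix (Fin q) (Fin q) ℝ}
    {O : Matrix (Fin r) (Fin r) ℝ} (hL : ∀ i j, i < j → L i j = 0) (hLd : ∀ i, 0 < L i i)
    (hO : O * Oᵀ = 1) (hB : B.submatrix ρ id = L * O.submatrix (Fin.castLE hqr) id)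
    {Z : Matrix (Fin r) (Fin n) ℝ}
    (h : LinearIndependent ℝ ((O * Z).submatrix (Fin.castLE hqr) id).row) :
    IsLQ ρ (B * Z) (B * (Z * lqV ((O * Z).submatrix (Fin.castLE hqr) id)))
      (lqV ((O * Z).submatrix (Fin.castLE hqr) id)) := by
  have hO' : Oᵀ * O = 1 := mul_eq_one_comm.1 hO
  set M := (O * Z).submatrix (Fin.castLE hqr) id with hM
  have hT : ∀ i j, (B * (Z * lqV M)) (ρ i) j = (L * (M * lqV M)) i j := fun i j => by
    have e1 : (B * (Z * lqV M)) (ρ i) j = (B.submatrix ρ id * (Z * lqV M)) i j := rfl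
    have e2 : M = O.submatrix (Fin.castLE hqr) id * Z := rfl
    rw [e1, hB, Matrix.mul_assoc, e2]
    simp only [Matrix.mul_assoc]
  refine ⟨?_, lqV_orthonormal h, fun i j hij => ?_, fun i => ?_⟩
  · have := mul_lqV_mul_transpose_of_top hqr hq h
    rw [← hM] at this
    have e : Z * lqV M * (lqV M)ᵀ = Z := by
      calc Z * lqV M * (lqV M)ᵀ = Oᵀ * O * (Z * lqV M * (lqV M)ᵀ) := by rw [hO', Matrix.one_mul]
        _ = Oᵀ * (O * Z * lqV M * (lqV M)ᵀ) := by simp only [Matrix.mul_assoc]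
        _ = Oᵀ * O * Z := by rw [this, Matrix.mul_assoc]
        _ = Z := by rw [hO', Matrix.one_mul]
    rw [Matrix.mul_assoc B, e]
  · rw [hT, Matrix.mul_apply]
    refine Finset.sum_eq_zero fun k _ => ?_
    rcases lt_or_ge i k with hik | hki
    · rw [hL i k hik, zero_mul]
    · rw [mul_lqV_lower M k j (hki.trans_lt hij), mul_zero]
  · rw [hT, Matrix.mul_apply, Finset.sum_eq_single i]
    · exact mul_pos (hLd i) (mul_lqV_diag_pos h i)
    · intro k _ hk
      rcases lt_or_gt_of_ne hk with hlt | hgt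
      · rw [mul_lqV_lower M k i hlt, mul_zero]
      · rw [hL i k hgt, zero_mul]
    · simp

end SingularWishart

namespace SingularWishart
open scoped ENNReal

/-! ### Negative moments of Gaussian determinants -/

/-- The order $-1/2$ exceeds $-1$, so the singularity at 0 is integrable. -/
theorem setLIntegral_enorm_rpow_lt_top :
    ∫⁻ x in Set.Ioo (-1 : ℝ) 1, ‖x‖ₑ ^ (-(1 / 2) : ℝ) < ⊤ := by
  have hpos : ∫⁻ x in Set.Ioc (0 : ℝ) 1, ‖x‖ₑ ^ (-(1 / 2) : ℝ) < ⊤ := by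
    have h := (intervalIntegral.intervalIntegrable_rpow' (a := 0) (b := 1)
      (r := -(1 / 2)) (by norm_num)).1.2
    refine lt_of_le_of_lt (le_of_eq ?_) h
    refine setLIntegral_congr_fun measurableSet_Ioc fun x hx => ?_
    simp only [Real.enorm_eq_ofReal_abs]
    rw [abs_of_pos hx.1, abs_of_pos (Real.rpow_pos_of_pos hx.1 _), ENNReal.ofReal_rpow_of_pos hx.1]
  have hneg : ∫⁻ x in Set.Ico (-1 : ℝ) 0, ‖x‖ₑ ^ (-(1 / 2) : ℝ) < ⊤ := by
    refine lt_of_le_of_lt (le_of_eq ?_) hpos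
    rw [← (Measure.measurePreserving_neg (volume : Measure ℝ)).setLIntegral_comp_preimage
      measurableSet_Ioc (by fun_prop)]
    simp
  have hsub : Set.Ioo (-1 : ℝ) 1 ⊆ Set.Ico (-1) 0 ∪ (Set.Ioc 0 1 ∪ {0}) := fun x hx => by
    rcases lt_trichotomy x 0 with h | h | h
    · exact Or.inl ⟨hx.1.le, h⟩
    · exact Or.inr (Or.inr h)
    · exact Or.inr (Or.inl ⟨h, hx.2.le⟩)
  refine (lintegral_mono_set hsub).trans_lt ((lintegral_union_le _ _ _).trans_lt ?_)
  refine ENNReal.add_lt_top.2 ⟨hneg, (lintegral_union_le _ _ _).trans_lt ?_⟩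
  refine ENNReal.add_lt_top.2 ⟨hpos, ?_⟩
  rw [setLIntegral_measure_zero _ _ (by simp)]
  exact ENNReal.zero_lt_top

/-- The density is at most $1/\sqrt{2\pi}<1$. -/
theorem gaussianReal_le_volume : gaussianReal 0 1 ≤ volume := by
  rw [gaussianReal_of_var_ne_zero _ one_ne_zero]
  calc volume.withDensity (gaussianPDF 0 1) ≤ volume.withDensity 1 := by
        refine withDensity_mono (Filter.Eventually.of_forall fun x => ?_)
        rw [gaussianPDF_def]
        refine ENNReal.ofReal_le_one.2 ?_
        rw [gaussianPDFReal]
        have h1 : 1 ≤ √(2 * Real.pi * ((1 : NNReal) : ℝ)) := by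
          rw [Real.one_le_sqrt]
          have := Real.pi_gt_three
          simp only [NNReal.coe_one]
          linarith
        have h2 : Real.exp (-(x - 0) ^ 2 / (2 * ((1 : NNReal) : ℝ))) ≤ 1 := by
          rw [Real.exp_le_one_iff, NNReal.coe_one]
          nlinarith [sq_nonneg (x - 0)]
        calc _ ≤ (1 : ℝ) * 1 := mul_le_mul (inv_le_one_of_one_le₀ h1) h2 (Real.exp_pos _).le
              zero_le_one
          _ = 1 := one_mul 1
    _ = volume := withDensity_one

/-- A bound for the moments of order `-1/2` of the distributions `N(t, 1)`. -/
noncomputable def negMomentBound : ℝ≥0∞ :=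
  1 + ∫⁻ x in Set.Ioo (-1 : ℝ) 1, ‖x‖ₑ ^ (-(1 / 2) : ℝ)

theorem negMomentBound_ne_top : negMomentBound ≠ ⊤ :=
  (ENNReal.add_lt_top.2 ⟨ENNReal.one_lt_top, setLIntegral_enorm_rpow_lt_top⟩).ne

/-- Away from $(-1,1)$ the power is at most 1; inside, the Gaussian is dominated by Lebesgue
measure, whose translation invariance makes the bound uniform in `t`. -/
theorem lintegral_shift_le (t : ℝ) :
    ∫⁻ x, ‖x + t‖ₑ ^ (-(1 / 2) : ℝ) ∂(gaussianReal 0 1) ≤ negMomentBound := by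
  set g : ℝ → ℝ≥0∞ := (Set.Ioo (-1 : ℝ) 1).indicator fun x => ‖x‖ₑ ^ (-(1 / 2) : ℝ) with hg
  have hgm : Measurable g := (by fun_prop : Measurable fun x : ℝ => ‖x‖ₑ ^ (-(1 / 2) : ℝ)).indicator
    measurableSet_Ioo
  have hle : ∀ x : ℝ, ‖x‖ₑ ^ (-(1 / 2) : ℝ) ≤ 1 + g x := fun x => by
    by_cases hx : x ∈ Set.Ioo (-1 : ℝ) 1
    · rw [hg, Set.indicator_of_mem hx]; exact le_add_self
    · refine le_add_right ?_
      have h1 : 1 ≤ |x| := by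
        by_contra h
        exact hx (abs_lt.1 (not_le.1 h))
      rw [ENNReal.rpow_neg, ENNReal.inv_le_one]
      refine ENNReal.one_le_rpow ?_ (by norm_num)
      rw [Real.enorm_eq_ofReal_abs]
      exact ENNReal.one_le_ofReal.2 h1
  calc ∫⁻ x, ‖x + t‖ₑ ^ (-(1 / 2) : ℝ) ∂(gaussianReal 0 1)
      ≤ ∫⁻ x, (1 + g (x + t)) ∂(gaussianReal 0 1) := lintegral_mono fun x => hle _
    _ = 1 + ∫⁻ x, g (x + t) ∂(gaussianReal 0 1) := by
        rw [lintegral_add_left measurable_const]; simp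
    _ ≤ 1 + ∫⁻ x, g (x + t) := by gcongr; exact gaussianReal_le_volume
    _ = negMomentBound := by
        rw [lintegral_add_right_eq_self g t, hg, lintegral_indicator measurableSet_Ioo]; rfl

theorem lintegral_affine_le (c a : ℝ) :
    ∫⁻ x, ‖x * c + a‖ₑ ^ (-(1 / 2) : ℝ) ∂(gaussianReal 0 1)
      ≤ negMomentBound * ‖c‖ₑ ^ (-(1 / 2) : ℝ) := by
  by_cases hc : c = 0
  -- For `c = 0` the right side is infinite, as $0^{-1/2}=\infty$ in `ℝ≥0∞`.
  · have h0 : negMomentBound ≠ 0 := by simp [negMomentBound]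
    simp [hc, ENNReal.zero_rpow_of_neg, ENNReal.mul_top h0]
  have e : ∀ x : ℝ, ‖x * c + a‖ₑ ^ (-(1 / 2) : ℝ)
      = ‖x + a / c‖ₑ ^ (-(1 / 2) : ℝ) * ‖c‖ₑ ^ (-(1 / 2) : ℝ) := fun x => by
    rw [← ENNReal.mul_rpow_of_ne_top (by simp) (by simp), ← enorm_mul]
    congr 3
    field_simp
  simp only [e]
  rw [lintegral_mul_const _ (by fun_prop)]
  gcongr
  exact lintegral_shift_le _

/-- The determinant is affine in its corner entry, with the complementary minor as slope. -/
theorem det_eq_add_mul_det_minor {k : ℕ} {A A' : Matrix (Fin (k + 1)) (Fin (k + 1)) ℝ}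
    (h : ∀ i j, (i, j) ≠ (0, 0) → A i j = A' i j) :
    A.det = A 0 0 * (A.submatrix Fin.succ Fin.succ).det
      + (A'.det - A' 0 0 * (A.submatrix Fin.succ Fin.succ).det) := by
  have hs : ∀ j : Fin (k + 1), A.submatrix Fin.succ j.succAbove = A'.submatrix Fin.succ j.succAbove :=
    fun j => by
      ext a b
      exact h _ _ (by simp [Fin.succ_ne_zero])
  have hs0 : A.submatrix Fin.succ Fin.succ = A'.submatrix Fin.succ Fin.succ := by
    ext a b
    exact h _ _ (by simp [Fin.succ_ne_zero])
  rw [Matrix.det_succ_row_zero A, Matrix.det_succ_row_zero A', Fin.sum_univ_succ, Fin.sum_univ_succ,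
    hs0]
  have e : ∀ j : Fin k, A 0 j.succ = A' 0 j.succ := fun j => h _ _ (by simp [Fin.succ_ne_zero])
  simp only [e, hs, Fin.succAbove_zero, Fin.val_zero, pow_zero, one_mul]
  rw [hs0]
  ring

theorem aemeasurable_det {Ω : Type*} [MeasurableSpace Ω] {μ : Measure Ω} {k : ℕ}
    {A : Ω → Matrix (Fin k) (Fin k) ℝ}
    (hA : ∀ i j, AEMeasurable (fun ω => A ω i j) μ) : AEMeasurable (fun ω => (A ω).det) μ := by
  simp only [Matrix.det_apply]
  exact Finset.aemeasurable_fun_sum _ fun σ _ =>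
    (Finset.aemeasurable_fun_prod _ fun i _ => hA _ _).const_smul _

theorem integrable_sq {Ω : Type*} [MeasurableSpace Ω] {μ : Measure Ω} {ι : Type*}
    {W : ι → Ω → ℝ} (hlaw : ∀ p, HasLaw (W p) (gaussianReal 0 1) μ) (p : ι) :
    Integrable (fun ω => W p ω ^ 2) μ := by
  have h : MemLp id 2 (gaussianReal 0 1) := memLp_id_gaussianReal 2
  have := (hlaw p).map_eq ▸ h
  exact ((memLp_map_measure_iff (by fun_prop) (hlaw p).aemeasurable).1 this).integrable_sq

section
variable {Ω : Type*} [MeasurableSpace Ω] {μ : Measure Ω} [IsProbabilityMeasure μ]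

/-- If one entry is standard Gaussian and independent of the others, then integrating it out
reduces the moment of order `-1/2` of the determinant to that of a minor. -/
theorem lintegral_det_rpow_succ_le {k : ℕ} {W : Fin (k + 1) × Fin (k + 1) → Ω → ℝ}
    (hind : iIndepFun W μ) (hlaw : ∀ p, HasLaw (W p) (gaussianReal 0 1) μ) :
    ∫⁻ ω, ‖(Matrix.of fun i j => W (i, j) ω).det‖ₑ ^ (-(1 / 2) : ℝ) ∂μ
      ≤ negMomentBound *
        ∫⁻ ω, ‖(Matrix.of fun i j : Fin k => W (i.succ, j.succ) ω).det‖ₑ ^ (-(1 / 2) : ℝ) ∂μ := by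
  classical
  have hm : ∀ p, AEMeasurable (W p) μ := fun p => (hlaw p).aemeasurable
  set S : Finset (Fin (k + 1) × Fin (k + 1)) := {(0, 0)} with hS
  have hmS : ((0, 0) : Fin (k + 1) × Fin (k + 1)) ∈ S := Finset.mem_singleton_self _
  have hi := hind.indepFun_finset₀ S Sᶜ disjoint_compl_right hm
  have hi2 : IndepFun (W (0, 0)) (fun ω (p : (Sᶜ : Finset _)) => W p ω) μ :=
    hi.comp (φ := fun x : (S → ℝ) => x ⟨(0, 0), hmS⟩) (ψ := id)
      (by fun_prop) measurable_id
  -- `Mat y x` rebuilds the matrix from its corner `x` and its other entries `y`, ready for Tonelli.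
  let Mat : (((Sᶜ : Finset (Fin (k + 1) × Fin (k + 1))) : Type) → ℝ) → ℝ →
      Matrix (Fin (k + 1)) (Fin (k + 1)) ℝ :=
    fun y x => Matrix.of fun i j => if h : (i, j) ∈ Sᶜ then y ⟨(i, j), h⟩ else x
  set Y : Ω → (((Sᶜ : Finset (Fin (k + 1) × Fin (k + 1))) : Type) → ℝ) :=
    fun ω p => W p ω with hY
  have hYm : AEMeasurable Y μ := aemeasurable_pi_lambda _ fun p => hm p
  have hMat : ∀ ω, Matrix.of (fun i j => W (i, j) ω) = Mat (Y ω) (W (0, 0) ω) := fun ω => by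
    ext i j
    simp only [Mat, Matrix.of_apply]
    split_ifs with h
    · rfl
    · have : (i, j) = (0, 0) := by simpa [hS] using h
      rw [this]
  have hdm : ∀ (l : ℕ) (f : Fin l → Fin (k + 1)), Measurable fun z : ℝ ×
      (((Sᶜ : Finset (Fin (k + 1) × Fin (k + 1))) : Type) → ℝ) =>
      ((Mat z.2 z.1).submatrix f f).det := fun l f => by
    simp only [Matrix.det_apply]
    refine Finset.measurable_sum _ fun σ _ => ?_
    refine Measurable.const_smul (Finset.measurable_prod _ fun i _ => ?_) _
    simp only [Mat, Matrix.submatrix_apply, Matrix.of_apply]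
    split_ifs <;> fun_prop
  have hFm : Measurable fun z : ℝ × (((Sᶜ : Finset (Fin (k + 1) × Fin (k + 1))) : Type) → ℝ) =>
      ‖(Mat z.2 z.1).det‖ₑ ^ (-(1 / 2) : ℝ) := by
    have := hdm (k + 1) id
    simp only [Matrix.submatrix_id_id] at this
    fun_prop
  have hGm : Measurable fun y : (((Sᶜ : Finset (Fin (k + 1) × Fin (k + 1))) : Type) → ℝ) =>
      ‖((Mat y 0).submatrix Fin.succ Fin.succ).det‖ₑ ^ (-(1 / 2) : ℝ) := by
    have := (hdm k Fin.succ).comp (measurable_prodMk_left (x := (0 : ℝ)))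
    simp only [Function.comp_def] at this
    fun_prop
  have hmap := (indepFun_iff_map_prod_eq_prod_map_map (hm (0, 0)) hYm).1 hi2
  rw [(hlaw (0, 0)).map_eq] at hmap
  have hPY : IsProbabilityMeasure (μ.map Y) := Measure.isProbabilityMeasure_map hYm
  calc ∫⁻ ω, ‖(Matrix.of fun i j => W (i, j) ω).det‖ₑ ^ (-(1 / 2) : ℝ) ∂μ
      = ∫⁻ ω, ‖(Mat (Y ω) (W (0, 0) ω)).det‖ₑ ^ (-(1 / 2) : ℝ) ∂μ := by simp only [hMat]
    _ = ∫⁻ z, ‖(Mat z.2 z.1).det‖ₑ ^ (-(1 / 2) : ℝ) ∂((gaussianReal 0 1).prod (μ.map Y)) := by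
        rw [← hmap, lintegral_map' hFm.aemeasurable ((hm _).prodMk hYm)]
    _ = ∫⁻ y, ∫⁻ x, ‖(Mat y x).det‖ₑ ^ (-(1 / 2) : ℝ) ∂(gaussianReal 0 1) ∂(μ.map Y) :=
        lintegral_prod_symm' _ hFm
    _ ≤ ∫⁻ y, negMomentBound * ‖((Mat y 0).submatrix Fin.succ Fin.succ).det‖ₑ ^ (-(1 / 2) : ℝ)
          ∂(μ.map Y) := by
        refine lintegral_mono fun y => ?_
        have hne : ∀ x i j, (i, j) ≠ ((0, 0) : Fin (k + 1) × Fin (k + 1)) →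
            Mat y x i j = Mat y 0 i j := fun x i j hij => by
          have : (i, j) ∈ Sᶜ := by simpa [hS] using hij
          simp only [Mat, Matrix.of_apply, dif_pos this]
        have h00 : ∀ x, Mat y x 0 0 = x := fun x => by
          have : ((0, 0) : Fin (k + 1) × Fin (k + 1)) ∉ Sᶜ := by simp [hS]
          simp only [Mat, Matrix.of_apply, dif_neg this]
        have hsub : ∀ x, (Mat y x).submatrix Fin.succ Fin.succ
            = (Mat y 0).submatrix Fin.succ Fin.succ := fun x => by
          ext a b
          exact hne x _ _ (by simp [Fin.succ_ne_zero])
        refine le_trans (le_of_eq ?_)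
          (lintegral_affine_le ((Mat y 0).submatrix Fin.succ Fin.succ).det (Mat y 0).det)
        refine lintegral_congr fun x => ?_
        rw [det_eq_add_mul_det_minor (hne x), h00, h00, hsub, zero_mul, sub_zero]
    _ = negMomentBound * ∫⁻ y, ‖((Mat y 0).submatrix Fin.succ Fin.succ).det‖ₑ ^ (-(1 / 2) : ℝ)
          ∂(μ.map Y) := lintegral_const_mul _ hGm
    _ = _ := by
        rw [lintegral_map' hGm.aemeasurable hYm]
        congr 2
        ext ω
        congr 3
        ext a b
        have : (a.succ, b.succ) ∈ Sᶜ := by simp [hS, Fin.succ_ne_zero]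
        simp only [Mat, Matrix.submatrix_apply, Matrix.of_apply, dif_pos this, hY]

theorem lintegral_det_rpow_le {k : ℕ} {W : Fin k × Fin k → Ω → ℝ}
    (hind : iIndepFun W μ) (hlaw : ∀ p, HasLaw (W p) (gaussianReal 0 1) μ) :
    ∫⁻ ω, ‖(Matrix.of fun i j => W (i, j) ω).det‖ₑ ^ (-(1 / 2) : ℝ) ∂μ ≤ negMomentBound ^ k := by
  induction k with
  | zero => simp
  | succ k ih =>
    refine (lintegral_det_rpow_succ_le hind hlaw).trans ?_
    rw [pow_succ']
    gcongr
    refine ih (W := fun p => W (p.1.succ, p.2.succ)) (hind.precomp ?_) fun p => hlaw _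
    rintro ⟨a, b⟩ ⟨c, d⟩ h
    simpa using h

variable {a b : ℕ} {W : Fin a × Fin b → Ω → ℝ}

theorem ae_det_submatrix_ne_zero (hind : iIndepFun W μ)
    (hlaw : ∀ p, HasLaw (W p) (gaussianReal 0 1) μ) {k : ℕ} (f : Fin k ↪ Fin a) (e : Fin k ↪ Fin b) :
    (∀ᵐ ω ∂μ, ((Matrix.of fun i j => W (i, j) ω).submatrix f e).det ≠ 0) ∧
      Integrable (fun ω => |((Matrix.of fun i j => W (i, j) ω).submatrix f e).det|
        ^ (-(1 / 2) : ℝ)) μ := by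
  have hinj : Function.Injective fun p : Fin k × Fin k => (f p.1, e p.2) := by
    rintro ⟨a, b⟩ ⟨c, d⟩ h
    simpa using h
  have hle := lintegral_det_rpow_le (W := fun p : Fin k × Fin k => W (f p.1, e p.2))
    (hind.precomp hinj) fun p => hlaw _
  set D : Ω → ℝ := fun ω => ((Matrix.of fun i j => W (i, j) ω).submatrix f e).det with hD
  have hDm : AEMeasurable D μ := aemeasurable_det fun i j => (hlaw _).aemeasurable
  have hlt : ∫⁻ ω, ‖D ω‖ₑ ^ (-(1 / 2) : ℝ) ∂μ < ⊤ :=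
    lt_of_le_of_lt hle (ENNReal.pow_lt_top negMomentBound_ne_top.lt_top)
  have hne : ∀ᵐ ω ∂μ, D ω ≠ 0 := by
    -- A zero determinant would make the integrand infinite, so the finite moment also proves
    -- nonvanishing.
    filter_upwards [ae_lt_top' (hDm.enorm.pow_const _) hlt.ne] with ω hω h0
    rw [h0] at hω
    simp at hω
  refine ⟨hne, (hDm.abs.pow_const _).aestronglyMeasurable, ?_⟩
  refine lt_of_le_of_lt (le_of_eq (lintegral_congr_ae ?_)) hlt
  filter_upwards [hne] with ω hω
  have hp := abs_pos.2 hω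
  rw [Real.enorm_eq_ofReal_abs, Real.enorm_eq_ofReal_abs, abs_of_pos (Real.rpow_pos_of_pos hp _),
    ENNReal.ofReal_rpow_of_pos hp]

theorem integrable_log_posEigenProd (hind : iIndepFun W μ)
    (hlaw : ∀ p, HasLaw (W p) (gaussianReal 0 1) μ) (hab : a ≤ b) :
    Integrable (fun ω => Real.log (posEigenProd
      ((Matrix.of fun i j => W (i, j) ω) * (Matrix.of fun i j => W (i, j) ω)ᵀ))) μ := by
  set Z : Ω → Matrix (Fin a) (Fin b) ℝ := fun ω => Matrix.of fun i j => W (i, j) ω with hZ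
  obtain ⟨hne, hint⟩ := ae_det_submatrix_ne_zero hind hlaw (Function.Embedding.refl _)
    (Fin.castLEEmb hab)
  have htr : Integrable (fun ω => (Z ω * (Z ω)ᵀ).trace) μ := by
    simp only [Matrix.trace, Matrix.diag_apply, Matrix.mul_apply, Matrix.transpose_apply]
    refine integrable_finsetSum _ fun i _ => integrable_finsetSum _ fun j _ => ?_
    simpa only [sq] using! integrable_sq hlaw (i, j)
  have hm : AEMeasurable (fun ω => (Z ω * (Z ω)ᵀ).det) μ := by
    refine aemeasurable_det fun i j => ?_
    simp only [Matrix.mul_apply, Matrix.transpose_apply]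
    exact Finset.aemeasurable_fun_sum _ fun k _ =>
      (hlaw (i, k)).aemeasurable.mul (hlaw (j, k)).aemeasurable
  have key : ∀ᵐ ω ∂μ, (Z ω * (Z ω)ᵀ).det ≠ 0 ∧ ‖Real.log (Z ω * (Z ω)ᵀ).det‖
      ≤ (Z ω * (Z ω)ᵀ).trace
        + 4 * |((Z ω).submatrix (Function.Embedding.refl _) (Fin.castLEEmb hab)).det|
          ^ (-(1 / 2) : ℝ) := by
    filter_upwards [hne] with ω hω
    have hle := sq_det_submatrix_le_det (Z ω) (Fin.castLEEmb hab)
    set D := ((Z ω).submatrix (Function.Embedding.refl _) (Fin.castLEEmb hab)).det with hD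
    have hle' : D ^ 2 ≤ (Z ω * (Z ω)ᵀ).det := hle
    have hDp := abs_pos.2 hω
    have hpos : 0 < (Z ω * (Z ω)ᵀ).det := lt_of_lt_of_le (by positivity) hle'
    refine ⟨hpos.ne', ?_⟩
    have hpd := posDef_mul_transpose hpos.ne'
    have h1 := log_det_le_trace hpd
    -- From $\log x\le x-1$ at $x=|D|^{-1/2}$: $2\log|D|=-4\log x\ge-4x$.
    have h2 : -(4 * |D| ^ (-(1 / 2) : ℝ)) ≤ Real.log (Z ω * (Z ω)ᵀ).det := by
      have h3 := Real.log_le_log (by positivity) hle'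
      have h4 := Real.log_le_sub_one_of_pos (Real.rpow_pos_of_pos hDp (-(1 / 2) : ℝ))
      rw [Real.log_rpow hDp] at h4
      rw [← sq_abs, Real.log_pow] at h3
      push_cast at h3
      linarith
    have h5 := hpd.posSemidef.trace_nonneg
    have h6 := Real.rpow_pos_of_pos hDp (-(1 / 2) : ℝ)
    rw [Real.norm_eq_abs, abs_le]
    constructor <;> linarith
  have hlog : Integrable (fun ω => Real.log (Z ω * (Z ω)ᵀ).det) μ :=
    (htr.add (hint.const_mul 4)).mono' (Real.measurable_log.comp_aemeasurable hm).aestronglyMeasurable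
      (key.mono fun ω hω => hω.2)
  refine hlog.congr (key.mono fun ω hω => ?_)
  change _ = Real.log (posEigenProd (Z ω * (Z ω)ᵀ))
  rw [posEigenProd_of_posDef (posDef_mul_transpose hω.1)]

end
end SingularWishart

/-! ### Gaussian matrices: entries, rotation invariance, second moments of $ZV$. -/

namespace SingularWishart

theorem hasLaw_coord {Ω : Type*} [MeasurableSpace Ω] {μ : Measure Ω} {r : ℕ}
    {Y : Ω → Fin r → ℝ}
    (h : HasLaw (fun ω => WithLp.toLp 2 (Y ω)) (stdGaussian (EuclideanSpace ℝ (Fin r))) μ) :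
    HasLaw Y (Measure.pi fun _ => gaussianReal 0 1) μ ∧
      ∀ i, HasLaw (fun ω => Y ω i) (gaussianReal 0 1) μ := by
  have h1 : HasLaw (WithLp.ofLp : EuclideanSpace ℝ (Fin r) → Fin r → ℝ)
      (Measure.pi fun _ => gaussianReal 0 1) (stdGaussian (EuclideanSpace ℝ (Fin r))) := by
    refine ⟨by fun_prop, ?_⟩
    rw [← map_pi_eq_stdGaussian, Measure.map_map (by fun_prop) (by fun_prop)]
    exact Measure.map_id
  have h2 : HasLaw Y (Measure.pi fun _ => gaussianReal 0 1) μ := h1.comp h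
  exact ⟨h2, fun i => ((measurePreserving_eval (fun _ : Fin r => gaussianReal 0 1) i).hasLaw).comp h2⟩

theorem aemeasurable_lqV {Ω : Type*} [MeasurableSpace Ω] {μ : Measure Ω} {r n q : ℕ}
    {W : Fin r × Fin n → Ω → ℝ} (hlaw : ∀ p, HasLaw (W p) (gaussianReal 0 1) μ) (hqr : q ≤ r)
    (a : Fin n) (i : Fin q) : AEMeasurable (fun ω =>
      lqV ((Matrix.of fun k a => W (k, a) ω).submatrix (Fin.castLE hqr) id) a i) μ :=
  (measurable_lqV a i).comp_aemeasurable (f := fun ω j b => W (Fin.castLE hqr j, b) ω)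
    (aemeasurable_pi_lambda _ fun _ => aemeasurable_pi_lambda _ fun _ => (hlaw _).aemeasurable)

theorem integrable_sq_mul_lqV {Ω : Type*} [MeasurableSpace Ω] {μ : Measure Ω} {r n q : ℕ}
    {W : Fin r × Fin n → Ω → ℝ} (hlaw : ∀ p, HasLaw (W p) (gaussianReal 0 1) μ) (hqr : q ≤ r)
    (k : Fin r) (i : Fin q) : Integrable (fun ω => ((Matrix.of fun k a => W (k, a) ω) *
      lqV ((Matrix.of fun k a => W (k, a) ω).submatrix (Fin.castLE hqr) id)) k i ^ 2) μ := by
  have hb : Integrable (fun ω => ∑ a, W (k, a) ω ^ 2) μ :=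
    integrable_finsetSum _ fun a _ => integrable_sq hlaw _
  refine hb.mono' ?_ (Filter.Eventually.of_forall fun ω => ?_)
  · simp only [Matrix.mul_apply]
    exact ((Finset.aemeasurable_fun_sum _ fun a _ =>
      (hlaw (k, a)).aemeasurable.mul (aemeasurable_lqV hlaw hqr a i)).pow_const 2).aestronglyMeasurable
  · rw [Real.norm_eq_abs, abs_of_nonneg (sq_nonneg _), Matrix.mul_apply]
    refine (Finset.sum_mul_sq_le_sq_mul_sq _ _ _).trans ?_
    exact mul_le_of_le_one_right (Finset.sum_nonneg fun a _ => sq_nonneg _) (sum_sq_lqV_le_one _ i)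

theorem IsStdGaussianMatrix.hasLaw {Ω : Type*} [MeasurableSpace Ω] {μ : Measure Ω}
    {r n : ℕ} {Z : Ω → Matrix (Fin r) (Fin n) ℝ}
    (hZ : IsStdGaussianMatrix μ Z) (p : Fin r × Fin n) :
    HasLaw (fun ω => Z ω p.1 p.2) (gaussianReal 0 1) μ :=
  (hasLaw_coord (hZ.law_col p.2)).2 p.1

/-- The law of a standard Gaussian matrix is invariant under rotations of its columns. -/
theorem IsStdGaussianMatrix.orthogonal_mul {Ω : Type*} [MeasurableSpace Ω] {μ : Measure Ω}
    {r n : ℕ} {Z : Ω → Matrix (Fin r) (Fin n) ℝ}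
    (hZ : IsStdGaussianMatrix μ Z) {O : Matrix (Fin r) (Fin r) ℝ} (hO : O * Oᵀ = 1) :
    IsStdGaussianMatrix μ fun ω => O * Z ω := by
  have hO' : Oᵀ * O = 1 := mul_eq_one_comm.1 hO
  let U : EuclideanSpace ℝ (Fin r) →ₗᵢ[ℝ] EuclideanSpace ℝ (Fin r) :=
    { toLinearMap := Matrix.toEuclideanLin O
      norm_map' := fun x => by
        have h : ‖Matrix.toEuclideanLin O x‖ ^ 2 = ‖x‖ ^ 2 := by
          rw [← real_inner_self_eq_norm_sq, ← real_inner_self_eq_norm_sq,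
            EuclideanSpace.inner_eq_star_dotProduct, EuclideanSpace.inner_eq_star_dotProduct]
          simp only [star_trivial]
          change (O *ᵥ x.ofLp) ⬝ᵥ (O *ᵥ x.ofLp) = _
          rw [Matrix.dotProduct_mulVec, Matrix.vecMul_mulVec, hO', Matrix.vecMul_one]
        exact (sq_eq_sq₀ (norm_nonneg _) (norm_nonneg _)).1 h }
  have hU : ∀ z : Fin r → ℝ, U (WithLp.toLp 2 z) = WithLp.toLp 2 (O *ᵥ z) := fun z => rfl
  have hcol : ∀ j ω, (WithLp.toLp 2 fun i => (O * Z ω) i j : EuclideanSpace ℝ (Fin r))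
      = U (WithLp.toLp 2 fun i => Z ω i j) := fun j ω => by
    rw [hU]; rfl
  refine ⟨fun j => ?_, ?_⟩
  · simp only [hcol]
    have hl : HasLaw U (stdGaussian (EuclideanSpace ℝ (Fin r)))
        (stdGaussian (EuclideanSpace ℝ (Fin r))) :=
      ⟨U.continuous.measurable.aemeasurable, by
        have := stdGaussian_map (U.toLinearIsometryEquiv rfl)
        rwa [LinearIsometry.coe_toLinearIsometryEquiv] at this⟩
    exact hl.comp (hZ.law_col j)
  · simp only [hcol]
    exact hZ.indep_col.comp (fun _ => U) fun _ => U.continuous.measurable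

section
variable {Ω : Type*} [MeasurableSpace Ω] {μ : Measure Ω} [IsProbabilityMeasure μ]

theorem IsStdGaussianMatrix.iIndepFun {r n : ℕ} {Z : Ω → Matrix (Fin r) (Fin n) ℝ}
    (hZ : IsStdGaussianMatrix μ Z) :
    iIndepFun (fun (p : Fin r × Fin n) ω => Z ω p.1 p.2) μ := by
  have hm : ∀ j i, AEMeasurable (fun ω => Z ω i j) μ := fun j i => (hZ.hasLaw (i, j)).aemeasurable
  have hcol : ∀ j, ProbabilityTheory.iIndepFun (fun i ω => Z ω i j) μ := fun j =>
    (iIndepFun_iff_hasLaw_pi_pi fun i => hZ.hasLaw (i, j)).2 (hasLaw_coord (hZ.law_col j)).1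
  have hcols : ProbabilityTheory.iIndepFun (fun (j : Fin n) ω (i : Fin r) => Z ω i j) μ :=
    hZ.indep_col.comp (fun _ => (WithLp.ofLp : EuclideanSpace ℝ (Fin r) → Fin r → ℝ))
      fun _ => by fun_prop
  -- The entries are only a.e. measurable, so independence is assembled on measurable versions and
  -- carried back.
  have hae : ∀ j, ∀ᵐ ω ∂μ, ∀ i, Z ω i j = (hm j i).mk _ ω := fun j =>
    ae_all_iff.2 fun i => (hm j i).ae_eq_mk
  have h := iIndepFun_uncurry' (P := μ) (X := fun (j : Fin n) (i : Fin r) => (hm j i).mk _)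
    (fun j i => (hm j i).measurable_mk)
    (hcols.congr fun j => (hae j).mono fun ω hω => funext hω)
    (fun j => (hcol j).congr fun i => (hm j i).ae_eq_mk)
  have h' : ProbabilityTheory.iIndepFun (fun (p : Fin n × Fin r) ω => Z ω p.2 p.1) μ :=
    h.congr fun p => (hm p.1 p.2).ae_eq_mk.symm
  exact h'.precomp (g := Prod.swap) Prod.swap_injective

variable {r n q : ℕ} {W : Fin r × Fin n → Ω → ℝ}

theorem integral_gaussian_mul (hind : iIndepFun W μ) (hlaw : ∀ p, HasLaw (W p) (gaussianReal 0 1) μ)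
    (p s : Fin r × Fin n) : Integrable (fun ω => W p ω * W s ω) μ ∧
      ∫ ω, W p ω * W s ω ∂μ = if p = s then 1 else 0 := by
  have h0 : ∀ p, ∫ ω, W p ω ∂μ = 0 := fun p => by
    rw [(hlaw p).integral_eq, integral_id_gaussianReal]
  have hint : ∀ p, Integrable (W p) μ := fun p => by
    have h : MemLp id 1 (gaussianReal 0 1) := memLp_id_gaussianReal 1
    have := (hlaw p).map_eq ▸ h
    exact ((memLp_map_measure_iff (by fun_prop) (hlaw p).aemeasurable).1 this).integrable le_rfl
  split_ifs with h
  · subst h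
    simp only [← sq]
    refine ⟨integrable_sq hlaw p, ?_⟩
    have hv := (hlaw p).variance_eq
    rw [variance_id_gaussianReal, variance_of_integral_eq_zero (hlaw p).aemeasurable (h0 p)] at hv
    simpa using hv
  · have hi := hind.indepFun h
    exact ⟨hi.integrable_mul (hint p) (hint s), by
      rw [hi.integral_fun_mul_eq_mul_integral (hint p).1 (hint s).1, h0, zero_mul]⟩

theorem ae_linearIndependent (hind : iIndepFun W μ)
    (hlaw : ∀ p, HasLaw (W p) (gaussianReal 0 1) μ) (hqr : q ≤ r) (hqn : q ≤ n) :
    ∀ᵐ ω ∂μ, LinearIndependent ℝ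
      ((Matrix.of fun k a => W (k, a) ω).submatrix (Fin.castLE hqr) id).row := by
  filter_upwards [(ae_det_submatrix_ne_zero hind hlaw (Fin.castLEEmb hqr) (Fin.castLEEmb hqn)).1]
    with ω hω
  exact linearIndependent_of_det_submatrix_ne_zero (e := Fin.castLEEmb hqn) hω

/-- Column `i` of $V$ uses rows up to `i` only, so it is independent of row `k`. In the expanded
square the cross terms have mean zero, and what remains is the expected squared norm of a unit
vector. -/
theorem integral_sq_mul_lqV_of_lt (hind : iIndepFun W μ)
    (hlaw : ∀ p, HasLaw (W p) (gaussianReal 0 1) μ) (hqr : q ≤ r) (hqn : q ≤ n)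
    {k : Fin r} {i : Fin q} (hik : i.1 < k.1) : ∫ ω, ((Matrix.of fun k a => W (k, a) ω) *
      lqV ((Matrix.of fun k a => W (k, a) ω).submatrix (Fin.castLE hqr) id)) k i ^ 2 ∂μ = 1 := by
  classical
  set V : Ω → Matrix (Fin n) (Fin q) ℝ := fun ω =>
    lqV ((Matrix.of fun k a => W (k, a) ω).submatrix (Fin.castLE hqr) id) with hV
  have hVm : ∀ a, AEMeasurable (fun ω => V ω a i) μ := fun a => aemeasurable_lqV hlaw hqr a i
  set S : Finset (Fin r × Fin n) := Finset.univ.filter fun p => p.1 < k with hS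
  set T : Finset (Fin r × Fin n) := Finset.univ.filter fun p => p.1 = k with hT
  have hST : Disjoint S T := Finset.disjoint_left.2 fun p hp hp' => by
    simp only [hS, hT, Finset.mem_filter, Finset.mem_univ, true_and] at hp hp'
    exact hp.ne hp'
  have hi := hind.indepFun_finset₀ S T hST fun p => (hlaw p).aemeasurable
  -- Rows from `k` on are replaced by 0, which does not affect column `i`.
  let φ : (S → ℝ) → Fin n → ℝ := fun y a => lqV (Matrix.of fun (j : Fin q) (b : Fin n) =>
    if h : (Fin.castLE hqr j, b) ∈ S then y ⟨_, h⟩ else 0) a i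
  have hφm : Measurable φ := measurable_pi_lambda _ fun a =>
    (measurable_lqV a i).comp (measurable_pi_lambda _ fun j => measurable_pi_lambda _ fun b => by
      split_ifs <;> fun_prop)
  have hφ : ∀ ω a, φ (fun p => W p ω) a = V ω a i := fun ω a => by
    refine lqV_congr i (fun j hj => ?_) a
    ext b
    have : (Fin.castLE hqr j, b) ∈ S := by
      simp only [hS, Finset.mem_filter, Finset.mem_univ, true_and]
      exact Fin.lt_def.2 (lt_of_le_of_lt (show (Fin.castLE hqr j).1 ≤ i.1 from hj) hik)
    simp only [Matrix.of_apply, dif_pos this]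
    rfl
  have hmem : ∀ a, (k, a) ∈ T := fun a => by simp [hT]
  have hindep : ∀ a b, IndepFun (fun ω => W (k, a) ω * W (k, b) ω)
      (fun ω => V ω a i * V ω b i) μ := fun a b => by
    have := hi.symm.comp (φ := fun z : (T → ℝ) => z ⟨(k, a), hmem a⟩ * z ⟨(k, b), hmem b⟩)
      (ψ := fun y => φ y a * φ y b) (by fun_prop) (by fun_prop)
    have e : (fun ω => V ω a i * V ω b i)
        = (fun y => φ y a * φ y b) ∘ fun ω (p : S) => W p ω := by
      ext ω
      simp only [Function.comp, hφ]
    rw [e]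
    exact this
  have hle : ∀ ω a, |V ω a i| ≤ 1 := fun ω a => by
    rw [← sq_le_one_iff_abs_le_one]
    exact (Finset.single_le_sum (f := fun a => (V ω a i) ^ 2) (fun _ _ => sq_nonneg _)
      (Finset.mem_univ a)).trans (sum_sq_lqV_le_one _ i)
  have hVint : ∀ a b, Integrable (fun ω => V ω a i * V ω b i) μ := fun a b => by
    refine Integrable.of_bound ((hVm a).mul (hVm b)).aestronglyMeasurable 1
      (Filter.Eventually.of_forall fun ω => ?_)
    rw [Real.norm_eq_abs, abs_mul]
    exact mul_le_one₀ (hle ω a) (abs_nonneg _) (hle ω b)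
  have hexp : ∀ ω, ((Matrix.of fun k a => W (k, a) ω) * V ω) k i ^ 2
      = ∑ a, ∑ b, (W (k, a) ω * W (k, b) ω) * (V ω a i * V ω b i) := fun ω => by
    rw [Matrix.mul_apply, sq, Finset.sum_mul_sum]
    refine Finset.sum_congr rfl fun a _ => Finset.sum_congr rfl fun b _ => ?_
    simp only [Matrix.of_apply]
    ring
  have hW := fun a b => integral_gaussian_mul hind hlaw (k, a) (k, b)
  have hint : ∀ a b, Integrable
      (fun ω => (W (k, a) ω * W (k, b) ω) * (V ω a i * V ω b i)) μ := fun a b =>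
    (hindep a b).integrable_mul (hW a b).1 (hVint a b)
  refine (integral_congr_ae (Filter.Eventually.of_forall hexp)).trans ?_
  rw [integral_finsetSum _ fun a _ => integrable_finsetSum _ fun b _ => hint a b]
  have hterm : ∀ a, ∫ ω, ∑ b, (W (k, a) ω * W (k, b) ω) * (V ω a i * V ω b i) ∂μ
      = ∫ ω, V ω a i * V ω a i ∂μ := fun a => by
    rw [integral_finsetSum _ fun b _ => hint a b, Finset.sum_eq_single a]
    · rw [(hindep a a).integral_fun_mul_eq_mul_integral (hW a a).1.1 (hVint a a).1, (hW a a).2,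
        if_pos rfl, one_mul]
    · intro b _ hb
      rw [(hindep a b).integral_fun_mul_eq_mul_integral (hW a b).1.1 (hVint a b).1, (hW a b).2,
        if_neg (by simpa using hb.symm), zero_mul]
    · simp
  rw [Finset.sum_congr rfl fun a _ => hterm a, ← integral_finsetSum _ fun a _ => hVint a a]
  have hone : (fun ω => ∑ a, V ω a i * V ω a i) =ᵐ[μ] fun _ => 1 := by
    filter_upwards [ae_linearIndependent hind hlaw hqr hqn] with ω hω
    have := congrFun (congrFun (lqV_orthonormal hω) i) i
    rwa [Matrix.one_apply_eq, Matrix.mul_apply] at this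
  rw [integral_congr_ae hone]
  simp

/-- By Parseval the squared entries of row `i` of $MV$ sum to the squared norm of the Gaussian row,
of mean $n$; the `i` entries left of the diagonal have second moment 1 each. -/
theorem integral_sq_mul_lqV_self (hind : iIndepFun W μ)
    (hlaw : ∀ p, HasLaw (W p) (gaussianReal 0 1) μ) (hqr : q ≤ r) (hqn : q ≤ n)
    (i : Fin q) : ∫ ω, ((Matrix.of fun k a => W (k, a) ω) *
      lqV ((Matrix.of fun k a => W (k, a) ω).submatrix (Fin.castLE hqr) id))
        (Fin.castLE hqr i) i ^ 2 ∂μ = n - i := by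
  set N : Ω → Matrix (Fin r) (Fin q) ℝ := fun ω => (Matrix.of fun k a => W (k, a) ω) *
      lqV ((Matrix.of fun k a => W (k, a) ω).submatrix (Fin.castLE hqr) id) with hN
  have hae : ∀ᵐ ω ∂μ, N ω (Fin.castLE hqr i) i ^ 2
      = ∑ a, W (Fin.castLE hqr i, a) ω ^ 2
        - ∑ j ∈ Finset.Iio i, N ω (Fin.castLE hqr i) j ^ 2 := by
    filter_upwards [ae_linearIndependent hind hlaw hqr hqn] with ω hω
    set M := (Matrix.of fun k a => W (k, a) ω).submatrix (Fin.castLE hqr) id with hM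
    have hNM : ∀ j, N ω (Fin.castLE hqr i) j = (M * lqV M) i j := fun j => rfl
    have hsq : ∑ j, ((M * lqV M) i j) ^ 2 = ∑ a, M i a ^ 2 := by
      have h1 : (M * lqV M) * (M * lqV M)ᵀ = M * Mᵀ := by
        rw [Matrix.transpose_mul, ← Matrix.mul_assoc, mul_lqV_mul_transpose hω]
      have h2 := congrFun (congrFun h1 i) i
      have h3 : ∀ (s : ℕ) (A : Matrix (Fin q) (Fin s) ℝ), (A * Aᵀ) i i = ∑ j, A i j ^ 2 :=
        fun s A => by simp only [Matrix.mul_apply, Matrix.transpose_apply, ← sq]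
      rwa [h3, h3] at h2
    have hsplit : ∑ j, ((M * lqV M) i j) ^ 2
        = ((M * lqV M) i i) ^ 2 + ∑ j ∈ Finset.Iio i, ((M * lqV M) i j) ^ 2 := by
      rw [← Finset.sum_subset (Finset.subset_univ (Finset.Iic i)), ← Finset.Iio_insert,
        Finset.sum_insert (by simp)]
      intro j _ hj
      rw [mul_lqV_lower M i j (by simpa using hj)]
      simp
    simp only [hNM]
    have : ∑ a, W (Fin.castLE hqr i, a) ω ^ 2 = ∑ a, M i a ^ 2 := rfl
    rw [this, ← hsq, hsplit]
    ring
  rw [integral_congr_ae hae, integral_sub (integrable_finsetSum _ fun a _ => integrable_sq hlaw _)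
    (integrable_finsetSum _ fun j _ => integrable_sq_mul_lqV hlaw hqr _ _),
    integral_finsetSum _ (fun a _ => integrable_sq hlaw _),
    integral_finsetSum _ fun j _ => integrable_sq_mul_lqV hlaw hqr _ _,
    Finset.sum_congr rfl fun j hj => integral_sq_mul_lqV_of_lt hind hlaw hqr hqn
      (k := Fin.castLE hqr i) (i := j) (show j < i from Finset.mem_Iio.1 hj)]
  have h1 : ∀ a, ∫ ω, W (Fin.castLE hqr i, a) ω ^ 2 ∂μ = 1 := fun a => by
    have := (integral_gaussian_mul hind hlaw (Fin.castLE hqr i, a) (Fin.castLE hqr i, a)).2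
    simpa only [← sq, if_true] using this
  simp [h1]

/-- The expected squared norm of the `i`-th column of `Z V`. -/
theorem integral_sum_sq_mul_lqV (hind : iIndepFun W μ)
    (hlaw : ∀ p, HasLaw (W p) (gaussianReal 0 1) μ) (hqr : q ≤ r) (hqn : q ≤ n)
    (i : Fin q) : ∫ ω, ∑ k, ((Matrix.of fun k a => W (k, a) ω) *
      lqV ((Matrix.of fun k a => W (k, a) ω).submatrix (Fin.castLE hqr) id)) k i ^ 2 ∂μ
        = n + r - 2 * (i + 1) + 1 := by
  rw [integral_finsetSum _ fun k _ => integrable_sq_mul_lqV hlaw hqr k i]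
  -- Column `i`, counted from 0: zeros above the diagonal, $n-i$ on it, and 1 for each of the
  -- $r-i-1$ rows below, including rows beyond `q`.
  have hk : ∀ k : Fin r, ∫ ω, ((Matrix.of fun k a => W (k, a) ω) *
      lqV ((Matrix.of fun k a => W (k, a) ω).submatrix (Fin.castLE hqr) id)) k i ^ 2 ∂μ
      = (if k = Fin.castLE hqr i then (n : ℝ) - i else 0)
        + if k ∈ Finset.Ioi (Fin.castLE hqr i) then 1 else 0 := fun k => by
    rcases lt_trichotomy k (Fin.castLE hqr i) with h | h | h
    · rw [if_neg h.ne, if_neg (by simpa using h.le), add_zero]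
      have hkq : k.1 < q := lt_trans h i.2
      have : ∀ ω, ((Matrix.of fun k a => W (k, a) ω) * lqV ((Matrix.of fun k a =>
          W (k, a) ω).submatrix (Fin.castLE hqr) id)) k i = 0 := fun ω =>
        mul_lqV_lower ((Matrix.of fun k a => W (k, a) ω).submatrix (Fin.castLE hqr) id)
          ⟨k.1, hkq⟩ i h
      simp [this]
    · rw [if_pos h, if_neg (by simp [h]), add_zero, h]
      exact integral_sq_mul_lqV_self hind hlaw hqr hqn i
    · rw [if_neg h.ne', if_pos (by simpa using h), zero_add]
      exact integral_sq_mul_lqV_of_lt hind hlaw hqr hqn h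
  simp only [hk]
  rw [Finset.sum_add_distrib, Finset.sum_ite_eq' Finset.univ, if_pos (Finset.mem_univ _),
    Finset.sum_boole]
  simp only [Finset.filter_univ_mem, Fin.card_Ioi, Fin.val_castLE]
  have : i.1 + 1 ≤ r := lt_of_lt_of_le i.2 hqr
  rw [Nat.sub_sub, Nat.cast_sub (by omega)]
  push_cast
  ring

end
end SingularWishart

/-! ### Risk formulas and scalar optimisation. -/

namespace SingularWishart

section
variable {Ω : Type*} [MeasurableSpace Ω] {μ : Measure Ω} [IsProbabilityMeasure μ]

theorem integrable_log_posEigenProd_of_isStdGaussianMatrix {r n : ℕ}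
    {Z : Ω → Matrix (Fin r) (Fin n) ℝ} (hZ : IsStdGaussianMatrix μ Z) :
    Integrable (fun ω => Real.log (posEigenProd (Z ω * (Z ω)ᵀ))) μ := by
  rcases le_total r n with h | h
  · have := integrable_log_posEigenProd hZ.iIndepFun hZ.hasLaw h
    have e : ∀ ω, (Matrix.of fun i j => Z ω i j) = Z ω := fun _ => rfl
    simpa only [e] using this
  -- For $n\le r$ the transpose is the wide matrix, and $Z^tZ$ has the same positive eigenvalues as
  -- $ZZ^t$.
  · have := integrable_log_posEigenProd (W := fun p : Fin n × Fin r => fun ω => Z ω p.2 p.1)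
      (hZ.iIndepFun.precomp (g := Prod.swap) Prod.swap_injective) (fun p => hZ.hasLaw (p.2, p.1)) h
    have e : ∀ ω, (Matrix.of fun i j => Z ω j i) = (Z ω)ᵀ := fun _ => rfl
    simp only [e, Matrix.transpose_transpose] at this
    simpa only [posEigenProd_mul_comm (Z _)] using this

/-- Almost surely the decomposition exists; the squared column norms of `Z V` have explicit
expectations. -/
theorem exists_ae_isLQ {p n r : ℕ} {Z : Ω → Matrix (Fin r) (Fin n) ℝ} (hZ : IsStdGaussianMatrix μ Z)
    {ρ : Fin (min n r) ↪ Fin p} {B : Matrix (Fin p) (Fin r) ℝ} (hB : B ∈ paramSpace ρ) :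
    ∃ N : Fin (min n r) → Ω → ℝ, (∀ i, Integrable (N i) μ) ∧
      (∀ i, ∫ ω, N i ω ∂μ = (n : ℝ) + (r : ℝ) - 2 * ((i : ℝ) + 1) + 1) ∧
      ∀ᵐ ω ∂μ, ∃ T V, IsLQ ρ (B * Z ω) T V ∧ ∀ i, ∑ k, ((Z ω * V) k i) ^ 2 = N i ω := by
  have hqr : min n r ≤ r := min_le_right _ _
  have hqn : min n r ≤ n := min_le_left _ _
  obtain ⟨L, O, hL, hLd, hO, hBO⟩ := exists_lower_mul_orthogonal hqr hB.2
  have hG := hZ.orthogonal_mul hO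
  refine ⟨fun i ω => ∑ k, ((O * Z ω) * lqV ((O * Z ω).submatrix (Fin.castLE hqr) id)) k i ^ 2,
    fun i => integrable_finsetSum _ fun k _ => integrable_sq_mul_lqV hG.hasLaw hqr k i,
    fun i => integral_sum_sq_mul_lqV hG.iIndepFun hG.hasLaw hqr hqn i, ?_⟩
  filter_upwards [ae_linearIndependent hG.iIndepFun hG.hasLaw hqr hqn] with ω hω
  refine ⟨_, _, isLQ_lqV hqr ?_ hL hLd hO hBO hω, fun i => ?_⟩
  · rcases le_total n r with h | h
    · exact Or.inr (min_eq_left h)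
    · exact Or.inl (min_eq_right h)
  -- Column norms are diagonal entries of a Gram matrix, from which $O$ cancels.
  · have h1 : ∀ A : Matrix (Fin r) (Fin (min n r)) ℝ, ∑ k, A k i ^ 2 = (Aᵀ * A) i i := fun A => by
      simp only [Matrix.mul_apply, Matrix.transpose_apply, ← sq]
    rw [h1, h1, Matrix.mul_assoc O, Matrix.transpose_mul O, Matrix.mul_assoc _ Oᵀ,
      ← Matrix.mul_assoc Oᵀ, mul_eq_one_comm.1 hO, Matrix.one_mul]

/-- The loss of `T D Tᵀ` is integrable, and its risk has a closed form. -/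
theorem integrable_lossVar_and_risk {p n r : ℕ} {Z : Ω → Matrix (Fin r) (Fin n) ℝ}
    (hZ : IsStdGaussianMatrix μ Z) {ρ : Fin (min n r) ↪ Fin p} {B : Matrix (Fin p) (Fin r) ℝ}
    (hB : B ∈ paramSpace ρ) {d : Fin (min n r) → ℝ} (hd : ∀ i, 0 < d i) :
    Integrable (lossVar Z (deltaT ρ d) B) μ ∧
      risk μ Z (deltaT ρ d) B
        = ∑ i, (d i * ((n : ℝ) + (r : ℝ) - 2 * ((i : ℝ) + 1) + 1) - Real.log (d i) - 1)
          - ∫ ω, Real.log (posEigenProd (Z ω * (Z ω)ᵀ)) ∂μ := by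
  obtain ⟨N, hNint, hN, hae⟩ := exists_ae_isLQ hZ hB
  have hπ := integrable_log_posEigenProd_of_isStdGaussianMatrix hZ
  have hloss : lossVar Z (deltaT ρ d) B =ᵐ[μ] fun ω => ∑ i, (d i * N i ω - Real.log (d i) - 1)
      - Real.log (posEigenProd (Z ω * (Z ω)ᵀ)) := by
    filter_upwards [hae] with ω hω
    obtain ⟨T, V, hTV, hNV⟩ := hω
    rw [lossVar, deltaT, hTV.lqT_eq, steinLoss_of_isLQ hB.1 hTV hd, Finset.sum_sub_distrib,
      Finset.sum_sub_distrib]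
    simp only [hNV, Finset.sum_const, Finset.card_univ, Fintype.card_fin, nsmul_eq_mul, mul_one]
    ring
  have hterm : ∀ i, Integrable (fun ω => d i * N i ω - Real.log (d i) - 1) μ := fun i =>
    (((hNint i).const_mul _).sub (integrable_const _)).sub (integrable_const _)
  have hsum := integrable_finsetSum Finset.univ fun i _ => hterm i
  refine ⟨(hsum.sub hπ).congr hloss.symm, ?_⟩
  rw [risk, integral_congr_ae hloss, integral_sub hsum hπ, integral_finsetSum _ fun i _ => hterm i]
  congr 1
  refine Finset.sum_congr rfl fun i _ => ?_
  have h1 : Integrable (fun ω => d i * N i ω - Real.log (d i)) μ :=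
    ((hNint i).const_mul _).sub (integrable_const _)
  rw [integral_sub h1 (integrable_const _), integral_sub ((hNint i).const_mul _) (integrable_const _), integral_const_mul, hN]
  simp

/-- $S=TT^t$ wherever the decomposition exists, which puts the multiples of $S$ into the class up to
a null set. -/
theorem lossVar_deltaC_ae_eq {p n r : ℕ} {Z : Ω → Matrix (Fin r) (Fin n) ℝ}
    (hZ : IsStdGaussianMatrix μ Z) {ρ : Fin (min n r) ↪ Fin p} {B : Matrix (Fin p) (Fin r) ℝ}
    (hB : B ∈ paramSpace ρ) (a : ℝ) :
    lossVar Z (deltaT ρ fun _ => a) B =ᵐ[μ] lossVar Z (deltaC a) B := by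
  obtain ⟨N, -, -, hae⟩ := exists_ae_isLQ hZ hB
  filter_upwards [hae] with ω hω
  obtain ⟨T, V, hTV, -⟩ := hω
  have h1 : B * Z ω * (B * Z ω)ᵀ = T * Tᵀ := by
    rw [hTV.eq_mul, Matrix.transpose_mul, Matrix.transpose_transpose, Matrix.mul_assoc,
      ← Matrix.mul_assoc Vᵀ, hTV.orthonormal, Matrix.one_mul]
  have h2 : Matrix.diagonal (fun _ : Fin (min n r) => a) = a • (1 : Matrix _ _ ℝ) := by
    rw [Matrix.smul_one_eq_diagonal]
  rw [lossVar, lossVar, deltaT, deltaC, hTV.lqT_eq, h1, h2, Matrix.mul_smul, Matrix.mul_one,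
    Matrix.smul_mul]

end

/-- This is $\log x\le x-1$ at $x=dc$, with equality only at $d=1/c$. -/
theorem log_le_mul_sub_log_sub_one {c d : ℝ} (hc : 0 < c) (hd : 0 < d) :
    Real.log c ≤ d * c - Real.log d - 1 := by
  have := Real.log_le_sub_one_of_pos (mul_pos hd hc)
  rw [Real.log_mul hd.ne' hc.ne'] at this
  linarith

theorem log_lt_mul_sub_log_sub_one {c d : ℝ} (hc : 0 < c) (hd : 0 < d) (h : d ≠ 1 / c) :
    Real.log c < d * c - Real.log d - 1 := by
  have := Real.log_lt_sub_one_of_pos (mul_pos hd hc) fun e => h (eq_one_div_of_mul_eq_one_left e)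
  rw [Real.log_mul hd.ne' hc.ne'] at this
  linarith

/-- The denominators average to $m$, the reason for the constant $1/m$. -/
theorem sum_dJS_denominators (n r : ℕ) :
    ∑ i : Fin (min n r), ((n : ℝ) + (r : ℝ) - 2 * ((i : ℝ) + 1) + 1)
      = (min n r : ℕ) * (max n r : ℕ) := by
  have h : ∀ (x : ℝ) (q : ℕ), ∑ i : Fin q, (x - 2 * ((i : ℝ) + 1) + 1) = q * (x - q) := fun x q => by
    induction q with
    | zero => simp
    | succ q ih =>
      rw [Fin.sum_univ_castSucc]
      simp only [Fin.val_castSucc, Fin.val_last, ih]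
      push_cast
      ring
  rw [h]
  have : (n : ℝ) + r = (min n r : ℕ) + (max n r : ℕ) := by exact_mod_cast (min_add_max n r).symm
  rw [this]
  ring

end SingularWishart

theorem mainTheorem5 {Ω : Type*} [MeasurableSpace Ω] (μ : Measure Ω) [IsProbabilityMeasure μ]
    (p n r : ℕ) (hn : 0 < n) (hr : 0 < r)
    (Z : Ω → Matrix (Fin r) (Fin n) ℝ) (hZ : SingularWishart.IsStdGaussianMatrix μ Z)
    (ρ : Fin (min n r) ↪ Fin p)
    (B : Matrix (Fin p) (Fin r) ℝ) (hB : B ∈ SingularWishart.paramSpace ρ) :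
    -- the decomposition exists and is unique with probability one
    (∀ᵐ ω ∂μ, ∃! TV : Matrix (Fin p) (Fin (min n r)) ℝ × Matrix (Fin n) (Fin (min n r)) ℝ,
      SingularWishart.IsLQ ρ (B * Z ω) TV.1 TV.2) ∧
    -- all risks are finite
    (∀ d : Fin (min n r) → ℝ, (∀ i, 0 < d i) →
      Integrable (SingularWishart.lossVar Z (SingularWishart.deltaT ρ d) B) μ) ∧
    (∀ a : ℝ, 0 < a → Integrable (SingularWishart.lossVar Z (SingularWishart.deltaC a) B) μ) ∧
    Integrable (SingularWishart.lossVar Z (SingularWishart.deltaBC r) B) μ ∧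
    -- the constants `dJS` are admissible, and they give the unique best estimator in the class
    (∀ i, 0 < SingularWishart.dJS n r i) ∧
    (∀ d : Fin (min n r) → ℝ, (∀ i, 0 < d i) → d ≠ SingularWishart.dJS n r →
      SingularWishart.risk μ Z (SingularWishart.deltaT ρ (SingularWishart.dJS n r)) B
        < SingularWishart.risk μ Z (SingularWishart.deltaT ρ d) B) ∧
    -- its risk is a constant that does not depend on `B`
    Integrable (fun ω => Real.log (SingularWishart.posEigenProd (Z ω * (Z ω)ᵀ))) μ ∧
    SingularWishart.risk μ Z (SingularWishart.deltaT ρ (SingularWishart.dJS n r)) B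
      = ∑ i : Fin (min n r), Real.log ((n : ℝ) + (r : ℝ) - 2 * ((i : ℝ) + 1) + 1)
        - ∫ ω, Real.log (SingularWishart.posEigenProd (Z ω * (Z ω)ᵀ)) ∂μ ∧
    -- `S / max n r` is the unique best constant multiple of `S`
    (∀ a : ℝ, 0 < a → a ≠ 1 / ((max n r : ℕ) : ℝ) →
      SingularWishart.risk μ Z (SingularWishart.deltaBC r) B
        < SingularWishart.risk μ Z (SingularWishart.deltaC a) B) ∧
    -- the estimator with the constants `dJS` dominates the best constant multiple estimator
    SingularWishart.risk μ Z (SingularWishart.deltaT ρ (SingularWishart.dJS n r)) B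
      ≤ SingularWishart.risk μ Z (SingularWishart.deltaBC r) B ∧
    (2 ≤ min n r →
      SingularWishart.risk μ Z (SingularWishart.deltaT ρ (SingularWishart.dJS n r)) B
        < SingularWishart.risk μ Z (SingularWishart.deltaBC r) B) := by
  classical
  have hc : ∀ i : Fin (min n r), 0 < (n : ℝ) + (r : ℝ) - 2 * ((i : ℝ) + 1) + 1 := fun i => by
    have h1 : (i : ℝ) + 1 ≤ n := by exact_mod_cast (lt_min_iff.1 i.2).1
    have h2 : (i : ℝ) + 1 ≤ r := by exact_mod_cast (lt_min_iff.1 i.2).2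
    linarith
  have hJSpos : ∀ i, 0 < SingularWishart.dJS n r i := fun i => one_div_pos.2 (hc i)
  have hq : 0 < min n r := lt_min hn hr
  have hm : (0 : ℝ) < (max n r : ℕ) := Nat.cast_pos.2 (lt_max_of_lt_left hn)
  have hT := fun (d : Fin (min n r) → ℝ) (hd : ∀ i, 0 < d i) =>
    SingularWishart.integrable_lossVar_and_risk hZ hB hd
  have hCae := fun a => SingularWishart.lossVar_deltaC_ae_eq hZ hB a
  have hCrisk : ∀ a, SingularWishart.risk μ Z (SingularWishart.deltaC a) B
      = SingularWishart.risk μ Z (SingularWishart.deltaT ρ fun _ => a) B := fun a =>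
    (integral_congr_ae (hCae a)).symm
  have hCint : ∀ a : ℝ, 0 < a →
      Integrable (SingularWishart.lossVar Z (SingularWishart.deltaC a) B) μ := fun a ha =>
    (hT _ fun _ => ha).1.congr (hCae a)
  have hJS : SingularWishart.risk μ Z (SingularWishart.deltaT ρ (SingularWishart.dJS n r)) B
      = ∑ i : Fin (min n r), Real.log ((n : ℝ) + (r : ℝ) - 2 * ((i : ℝ) + 1) + 1)
        - ∫ ω, Real.log (SingularWishart.posEigenProd (Z ω * (Z ω)ᵀ)) ∂μ := by
    rw [(hT _ hJSpos).2]
    congr 1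
    refine Finset.sum_congr rfl fun i _ => ?_
    rw [SingularWishart.dJS, one_div_mul_cancel (hc i).ne', one_div, Real.log_inv]
    ring
  have hbest : ∀ d : Fin (min n r) → ℝ, (∀ i, 0 < d i) → d ≠ SingularWishart.dJS n r →
      SingularWishart.risk μ Z (SingularWishart.deltaT ρ (SingularWishart.dJS n r)) B
        < SingularWishart.risk μ Z (SingularWishart.deltaT ρ d) B := fun d hd hne => by
    rw [hJS, (hT d hd).2]
    refine sub_lt_sub_right ?_ _
    obtain ⟨i, hi⟩ := Function.ne_iff.1 hne
    exact Finset.sum_lt_sum (fun i _ => SingularWishart.log_le_mul_sub_log_sub_one (hc i) (hd i))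
      ⟨i, Finset.mem_univ _, SingularWishart.log_lt_mul_sub_log_sub_one (hc i) (hd i) hi⟩
  have hconst : ∀ a : ℝ, 0 < a → SingularWishart.risk μ Z (SingularWishart.deltaC a) B
      = (min n r : ℕ) * (a * (max n r : ℕ) - Real.log a - 1)
        - ∫ ω, Real.log (SingularWishart.posEigenProd (Z ω * (Z ω)ᵀ)) ∂μ := fun a ha => by
    rw [hCrisk, (hT _ fun _ => ha).2]
    congr 1
    rw [Finset.sum_sub_distrib, Finset.sum_sub_distrib, ← Finset.mul_sum,
      SingularWishart.sum_dJS_denominators]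
    simp only [Finset.sum_const, Finset.card_univ, Fintype.card_fin, nsmul_eq_mul]
    ring
  have hBC : SingularWishart.risk μ Z (SingularWishart.deltaBC r) B
      = SingularWishart.risk μ Z (SingularWishart.deltaT ρ fun _ => 1 / ((max n r : ℕ) : ℝ)) B :=
    hCrisk _
  refine ⟨?_, fun d hd => (hT d hd).1, hCint, hCint _ (one_div_pos.2 hm), hJSpos, hbest,
    SingularWishart.integrable_log_posEigenProd_of_isStdGaussianMatrix hZ, hJS, ?_, ?_, ?_⟩
  · obtain ⟨N, -, -, hae⟩ := SingularWishart.exists_ae_isLQ hZ hB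
    filter_upwards [hae] with ω hω
    obtain ⟨T, V, hTV, -⟩ := hω
    refine ⟨(T, V), hTV, fun TV' h' => ?_⟩
    obtain ⟨h1, h2⟩ := SingularWishart.IsLQ.unique h' hTV
    exact Prod.ext h1 h2
  · intro a ha hne
    have e : SingularWishart.risk μ Z (SingularWishart.deltaBC r) B = _ :=
      hconst _ (one_div_pos.2 hm)
    rw [e, hconst a ha]
    refine sub_lt_sub_right (mul_lt_mul_of_pos_left ?_ (Nat.cast_pos.2 hq)) _
    have := SingularWishart.log_lt_mul_sub_log_sub_one hm ha hne
    rw [one_div_mul_cancel hm.ne', one_div, Real.log_inv]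
    linarith
  · rw [hBC]
    -- The two estimators' constants coincide when $q=1$.
    by_cases h : (fun _ => 1 / ((max n r : ℕ) : ℝ)) = SingularWishart.dJS n r
    · rw [h]
    · exact (hbest _ (fun _ => one_div_pos.2 hm) h).le
  · intro h2
    rw [hBC]
    refine hbest _ (fun _ => one_div_pos.2 hm) fun h => ?_
    -- Equality would make the first two constants equal, yet their denominators differ by 2.
    have e := (congrFun h ⟨0, hq⟩).symm.trans (congrFun h ⟨1, h2⟩)
    simp only [SingularWishart.dJS, one_div, _root_.inv_inj] at e
    norm_num at e
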